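/- Let $B$ be a $C^*$-algebra with multiplier algebra $M(B)$, let $A\subseteq M(B)$ be a commutative $C^*$-subalgebra (a norm-closed $*$-subalgebra, not necessarily containing the unit of $M(B)$), and let $\rho:A\to B(\mathfrak H)$ be a $*$-representation of $A$ on a Hilbert space $\mathfrak H$. Let $\Phi:B\to B(\mathfrak H)$ be a completely bounded linear map, i.e. $\|\Phi\|_{cb}=\sup_n\|\Phi_n\|<\infty$, where $\Phi_n:M_n(B)\to M_n(B(\mathfrak H))$ applies $\Phi$ to the matrix entries, and assume that $\Phi$ is an $A$-bimodule map: $\Phi(ab)=\rho(a)\Phi(b)$ and $\Phi(ba)=\Phi(b)\rho(a)$ for all $a\in A$, $b\in B$. Then there exist a Hilbert space $\mathfrak L$, a nondegenerate $*$-representation $\pi$ of $B$ on $\mathfrak L$, which therefore extends uniquely to a unital $*$-representation, again denoted $\pi$, of $M(B)$ on $\mathfrak L$, and bounded left $A$-module maps $S,T:\mathfrak H\to\mathfrak L$ (that is, $S\rho(a)=\pi(a)S$ and $T\rho(a)=\pi(a)T$ for all $a\in A$) such that $$\Phi(b)=S^*\pi(b)T\qquad\text{for all } b\in B,$$ and such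 that moreover $\|\Phi\|_{cb}=\|S\|\,\|T\|$. -/

import Mathlib

open scoped MultiplierAlgebra ENNReal

namespace OperatorModule

/-- The norm `‖Φₙ‖` of the `n`-th amplification `Φₙ : Mₙ(B) → Mₙ(C)` of a linear map `Φ : B → C`
between C⋆-algebras, as an extended nonnegative real. `Φₙ` applies `Φ` to all matrix entries, and
`CStarMatrix` carries the C⋆-norm. -/
noncomputable def amplificationNorm {B C : Type*}
    [NonUnitalCStarAlgebra B] [PartialOrder B] [StarOrderedRing B]
    [NonUnitalCStarAlgebra C] [PartialOrder C] [StarOrderedRing C]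
    (Φ : B →ₗ[ℂ] C) (n : ℕ) : ℝ≥0∞ :=
  ⨆ (M : CStarMatrix (Fin n) (Fin n) B) (_ : ‖M‖ ≤ 1), ‖M.map Φ‖ₑ

/-- The completely bounded norm `‖Φ‖_cb = supₙ ‖Φₙ‖`. -/
noncomputable def cbNorm {B C : Type*}
    [NonUnitalCStarAlgebra B] [PartialOrder B] [StarOrderedRing B]
    [NonUnitalCStarAlgebra C] [PartialOrder C] [StarOrderedRing C]
    (Φ : B →ₗ[ℂ] C) : ℝ≥0∞ :=
  ⨆ n : ℕ, amplificationNorm Φ n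

/-- `Φ` is completely bounded if `‖Φ‖_cb < ∞`. -/
def IsCompletelyBounded {B C : Type*}
    [NonUnitalCStarAlgebra B] [PartialOrder B] [StarOrderedRing B]
    [NonUnitalCStarAlgebra C] [PartialOrder C] [StarOrderedRing C]
    (Φ : B →ₗ[ℂ] C) : Prop :=
  cbNorm Φ < ∞

/-- A representation `π` of a C⋆-algebra `B` on a Hilbert space `K` is nondegenerate if the vectors
`π(b) ξ` span a dense subspace of `K`. -/
def IsNondegenerate {B K : Type*} [NonUnitalNonAssocSemiring B] [Star B] [Module ℂ B]
    [NormedAddCommGroup K] [InnerProductSpace ℂ K] [CompleteSpace K]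
    (π : B →⋆ₙₐ[ℂ] (K →L[ℂ] K)) : Prop :=
  Dense (Submodule.span ℂ {x : K | ∃ (b : B) (ξ : K), π b ξ = x} : Set K)

/-- `Φ : B → B(H)` is an `A`-bimodule map, where `A ⊆ M(B)` acts on `B` by multiplication
(`a · b = a.fst b` and `b · a = a.snd b`) and on `B(H)` through the representation `ρ`. -/
structure IsBimoduleMap {B H : Type*} [NonUnitalCStarAlgebra B]
    [NormedAddCommGroup H] [InnerProductSpace ℂ H] [CompleteSpace H]
    (A : NonUnitalStarSubalgebra ℂ 𝓜(ℂ, B)) (ρ : A →⋆ₙₐ[ℂ] (H →L[ℂ] H))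
    (Φ : B →ₗ[ℂ] (H →L[ℂ] H)) : Prop where
  map_left : ∀ (a : A) (b : B), Φ ((a : 𝓜(ℂ, B)).fst b) = ρ a * Φ b
  map_right : ∀ (a : A) (b : B), Φ ((a : 𝓜(ℂ, B)).snd b) = Φ b * ρ a

/-- If `A` acts nondegenerately on `H`, then the `A`-bimodule maps `Φ : B → B(H)` are exactly the
linear maps with `Φ(a b a') = a Φ(b) a'` for all `b ∈ B` and `a, a' ∈ A`. -/
theorem isBimoduleMap_iff_of_isNondegenerate {B H : Type*} [NonUnitalCStarAlgebra B]
    [NormedAddCommGroup H] [InnerProductSpace ℂ H] [CompleteSpace H]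
    (A : NonUnitalStarSubalgebra ℂ 𝓜(ℂ, B)) (ρ : A →⋆ₙₐ[ℂ] (H →L[ℂ] H))
    (hρ : IsNondegenerate ρ) (Φ : B →ₗ[ℂ] (H →L[ℂ] H)) :
    IsBimoduleMap A ρ Φ ↔ ∀ (a a' : A) (b : B),
      Φ ((a : 𝓜(ℂ, B)).fst ((a' : 𝓜(ℂ, B)).snd b)) = ρ a * Φ b * ρ a' := by
  have key : ∀ X Y : H →L[ℂ] H, (∀ a : A, X * ρ a = Y * ρ a) → X = Y := by
    intro X Y h
    refine ContinuousLinearMap.ext_on hρ ?_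
    rintro _ ⟨a, ξ, rfl⟩
    exact congrArg (fun Z : H →L[ℂ] H => Z ξ) (h a)
  have comm : ∀ (a a' : 𝓜(ℂ, B)) (b : B), a.fst (a'.snd b) = a'.snd (a.fst b) := by
    have cancel : ∀ x y : B, (∀ c : B, c * x = c * y) → x = y := by
      intro x y h
      have h1 := h (star (x - y))
      rw [← sub_eq_zero, ← mul_sub, CStarRing.star_mul_self_eq_zero_iff, sub_eq_zero] at h1
      exact h1
    have cancel' : ∀ x y : B, (∀ c : B, x * c = y * c) → x = y := by
      intro x y h
      have h1 := h (star (x - y))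
      rw [← sub_eq_zero, ← sub_mul, CStarRing.mul_star_self_eq_zero_iff, sub_eq_zero] at h1
      exact h1
    have mfst : ∀ (m : 𝓜(ℂ, B)) (x y : B), m.fst (x * y) = m.fst x * y := by
      intro m x y
      refine cancel _ _ fun c => ?_
      rw [← m.central, ← mul_assoc, ← mul_assoc, m.central]
    have msnd : ∀ (m : 𝓜(ℂ, B)) (x y : B), m.snd (x * y) = x * m.snd y := by
      intro m x y
      refine cancel' _ _ fun c => ?_
      rw [m.central, mul_assoc, mul_assoc, m.central]
    intro a a' b
    refine cancel' _ _ fun c => ?_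
    rw [← mfst, a'.central, a'.central, mfst]
  constructor
  · rintro ⟨h1, h2⟩ a a' b
    rw [h1, h2, mul_assoc]
  · intro h
    have key' : ∀ X Y : H →L[ℂ] H,
        (∀ a₁ a₂ : A, ρ a₁ * X * ρ a₂ = ρ a₁ * Y * ρ a₂) → X = Y := by
      intro X Y hXY
      refine star_injective (key _ _ fun a => star_injective ?_)
      rw [star_mul, star_mul, star_star, star_star, ← map_star]
      exact key _ _ fun a₂ => hXY (star a) a₂
    refine ⟨fun a b => key' _ _ fun a₁ a₂ => ?_, fun a b => key' _ _ fun a₁ a₂ => ?_⟩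
    · have h1 := h (a₁ * a) a₂ b
      rw [← h]
      rw [map_mul, mul_assoc (ρ a₁)] at h1
      rw [← comm, ← h1]
      rfl
    · have h1 := h a₁ (a * a₂) b
      rw [← h]
      rw [map_mul, ← mul_assoc, mul_assoc (ρ a₁)] at h1
      exact h1

/-- A nondegenerate representation `π` of `B` on `K` extends in exactly one way to a unital
representation of the multiplier algebra `M(B)` on `K`; `IsMultiplierExtension π π'` says that `π'`
is this extension. -/
def IsMultiplierExtension {B K : Type*} [NonUnitalCStarAlgebra B]
    [NormedAddCommGroup K] [InnerProductSpace ℂ K] [CompleteSpace K]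
    (π : B →⋆ₙₐ[ℂ] (K →L[ℂ] K)) (π' : 𝓜(ℂ, B) →⋆ₐ[ℂ] (K →L[ℂ] K)) : Prop :=
  ∀ b : B, π' (b : 𝓜(ℂ, B)) = π b

/-- The extension of a nondegenerate representation to the multiplier algebra is unique. -/
theorem IsMultiplierExtension.unique {B K : Type*} [NonUnitalCStarAlgebra B]
    [NormedAddCommGroup K] [InnerProductSpace ℂ K] [CompleteSpace K]
    {π : B →⋆ₙₐ[ℂ] (K →L[ℂ] K)} (hπ : IsNondegenerate π)
    {π₁ π₂ : 𝓜(ℂ, B) →⋆ₐ[ℂ] (K →L[ℂ] K)}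
    (h₁ : IsMultiplierExtension π π₁) (h₂ : IsMultiplierExtension π π₂) : π₁ = π₂ := by
  have cancel : ∀ x y : B, (∀ c : B, c * x = c * y) → x = y := by
    intro x y h
    have h1 := h (star (x - y))
    rw [← sub_eq_zero, ← mul_sub, CStarRing.star_mul_self_eq_zero_iff, sub_eq_zero] at h1
    exact h1
  have hmul : ∀ (m : 𝓜(ℂ, B)) (b : B), m * (b : 𝓜(ℂ, B)) = ((m.fst b : B) : 𝓜(ℂ, B)) := by
    intro m b
    refine DoubleCentralizer.ext _ _ _ _ (Prod.ext ?_ ?_)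
    · ext x
      refine cancel _ _ fun c => ?_
      simp only [DoubleCentralizer.mul_fst, DoubleCentralizer.coe_fst,
        ContinuousLinearMap.mul_apply', ContinuousLinearMap.mul_def,
        ContinuousLinearMap.comp_apply]
      rw [← m.central, ← mul_assoc, ← mul_assoc, m.central]
    · ext x
      simp only [DoubleCentralizer.mul_snd, DoubleCentralizer.coe_snd,
        ContinuousLinearMap.mul_def, ContinuousLinearMap.comp_apply,
        ContinuousLinearMap.flip_apply, ContinuousLinearMap.mul_apply']
      exact m.central x b
  ext1 m
  refine ContinuousLinearMap.ext_on hπ ?_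
  rintro _ ⟨b, ξ, rfl⟩
  have e₁ : π₁ m * π b = π (m.fst b) := by rw [← h₁ b, ← map_mul, hmul, h₁]
  have e₂ : π₂ m * π b = π (m.fst b) := by rw [← h₂ b, ← map_mul, hmul, h₂]
  exact congrArg (fun Z : K →L[ℂ] K => Z ξ) (e₁.trans e₂.symm)

/-- `S : H → K` is a left `A`-module map, where `A ⊆ M(B)` acts on `H` through `ρ` and on `K`
through the restriction to `A` of the representation `π'` of `M(B)`. -/
def IsLeftModuleMap {B H K : Type*} [NonUnitalCStarAlgebra B]
    [NormedAddCommGroup H] [InnerProductSpace ℂ H] [CompleteSpace H]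
    [NormedAddCommGroup K] [InnerProductSpace ℂ K] [CompleteSpace K]
    (A : NonUnitalStarSubalgebra ℂ 𝓜(ℂ, B)) (ρ : A →⋆ₙₐ[ℂ] (H →L[ℂ] H))
    (π' : 𝓜(ℂ, B) →⋆ₐ[ℂ] (K →L[ℂ] K)) (S : H →L[ℂ] K) : Prop :=
  ∀ (a : A) (ξ : H), S (ρ a ξ) = π' (a : 𝓜(ℂ, B)) (S ξ)

end OperatorModule

universe u v

/-! Write κ for `‖Φ‖_cb`, and suppose that `A` has been enlarged to a unital algebra of multipliers.
A representation π of `M(B)` with maps `S, T : H → K` gives vectors `e p`, indexed by two copies of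
`H`: `S h` on the first, `T h` on the second. The functionals `m ↦ ⟪e p, π m (e q)⟫` form a positive
definite kernel on `H ⊕ H`. For the theorem it is enough that on `A` both diagonal blocks equal `κ
⟪h, ρ(·) k⟫` and that on `B` the upper corner equals `⟪h, Φ(·) k⟫`. Such a kernel is thus prescribed
only on subspaces of `M(B)`, and it has to be extended.

The extension exists by M. Riesz's theorem, because diagonal scalars dominate every finitely
supported matrix (`exists_positive_extension`); `exists_kolmogorov_decomposition` then yields π and
`e`. The Gram relations alone force `S` and `T` to be linear, bounded by √κ and `A`-linear
(`exists_bimodule_dilation`).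

The analytic core is positivity of the prescribed data (`re_inner_nonneg_of_rows`). If the matrix
with diagonal blocks `a`, `a'` and corner `b` has nonnegative real part, put `r = (a + a* +
ε)^{1/2}` and `r' = (a' + a'* + ε)^{1/2}`. Then `c = r⁻¹ b r'⁻¹` is a contraction over `B`, so
`‖Φₙ(c)‖ ≤ κ`. The bimodule property gives `Φₙ(b) = ρ(r) Φₙ(c) ρ(r')`, and the Cauchy–Schwarz and
arithmetic–geometric inequalities bound the corner by the diagonal as ε tends to 0.

Finally π is cut down to the closed span of `π(B)K`. The factorization gives `κ ≤ ‖S‖‖T‖`, and the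
bounds by √κ give the reverse inequality. -/

namespace OperatorModule

/-! ### Matrices of operators as operators on a finite direct sum. -/

section MatrixOperators

variable {n H : Type*} [Fintype n] [NormedAddCommGroup H] [InnerProductSpace ℂ H]

/-- The operator on `Hⁿ` given by a square matrix of operators on `H`. -/
noncomputable def matrixOperator (C : CStarMatrix n n (H →L[ℂ] H)) :
    PiLp 2 (fun _ : n => H) →L[ℂ] PiLp 2 (fun _ : n => H) :=
  (PiLp.continuousLinearEquiv 2 ℂ (fun _ : n => H)).symm.toContinuousLinearMap ∘L
    ContinuousLinearMap.pi fun i => ∑ j, C i j ∘L PiLp.proj 2 (fun _ : n => H) j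

@[simp]
theorem matrixOperator_apply (C : CStarMatrix n n (H →L[ℂ] H)) (x : PiLp 2 (fun _ : n => H))
    (i : n) : matrixOperator C x i = ∑ j, C i j (x j) := by
  simp [matrixOperator]

theorem inner_matrixOperator (C : CStarMatrix n n (H →L[ℂ] H)) (x y : PiLp 2 (fun _ : n => H)) :
    inner ℂ x (matrixOperator C y) = ∑ i, ∑ j, inner ℂ (x i) (C i j (y j)) := by
  simp [PiLp.inner_apply, inner_sum]

variable [CompleteSpace H]

/-- The identification of matrices of operators on `H` with operators on `Hⁿ`. -/
noncomputable def matrixOperatorHom :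
    CStarMatrix n n (H →L[ℂ] H) →⋆ₙₐ[ℂ]
      (PiLp 2 (fun _ : n => H) →L[ℂ] PiLp 2 (fun _ : n => H)) where
  toFun := matrixOperator
  map_smul' c C := by ext; simp [Finset.smul_sum]
  map_zero' := by ext; simp
  map_add' C D := by ext; simp [Finset.sum_add_distrib]
  map_mul' C D := by
    ext x i
    simp only [matrixOperator_apply, CStarMatrix.mul_apply, _root_.sum_apply,
      _root_.mul_apply_eq_comp, map_sum]
    exact Finset.sum_comm
  map_star' C := by
    rw [ContinuousLinearMap.star_eq_adjoint, ContinuousLinearMap.eq_adjoint_iff]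
    intro x y
    rw [inner_matrixOperator, ← inner_conj_symm, inner_matrixOperator, map_sum, Finset.sum_comm]
    refine Finset.sum_congr rfl fun i _ => ?_
    rw [map_sum]
    refine Finset.sum_congr rfl fun j _ => ?_
    rw [inner_conj_symm, CStarMatrix.star_apply, ContinuousLinearMap.star_eq_adjoint,
      ContinuousLinearMap.adjoint_inner_left]

@[simp]
theorem matrixOperatorHom_apply (C : CStarMatrix n n (H →L[ℂ] H)) :
    matrixOperatorHom (n := n) (H := H) C = matrixOperator C := rfl

theorem matrixOperatorHom_injective :
    Function.Injective (matrixOperatorHom (n := n) (H := H)) := by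
  classical
  rw [injective_iff_map_eq_zero]
  intro C hC
  ext i j x
  have h := congrArg (fun T => T (WithLp.toLp 2 (Pi.single j x)) i) hC
  rw [matrixOperatorHom_apply] at h
  simpa [Pi.single_apply, apply_ite] using h

/-- An injective star homomorphism of C⋆-algebras is isometric. This turns the abstract matrix norm
in `cbNorm` into estimates on vectors. -/
theorem norm_matrixOperator (C : CStarMatrix n n (H →L[ℂ] H)) : ‖matrixOperator C‖ = ‖C‖ :=
  NonUnitalStarAlgHom.norm_map matrixOperatorHom matrixOperatorHom_injective C

end MatrixOperators

/-! ### Testing the matrix norm on rows. -/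

section RowTests

variable {n A : Type*} [Fintype n] [NonUnitalCStarAlgebra A] [PartialOrder A] [StarOrderedRing A]

/-- A matrix acting contractively on rows is a contraction. -/
theorem norm_le_one_of_rows {c : CStarMatrix n n A}
    (h : ∀ x : n → A, ‖∑ j, (∑ i, x i * c i j) * star (∑ i, x i * c i j)‖ ≤
      ‖∑ i, x i * star (x i)‖) : ‖c‖ ≤ 1 := by
  rw [CStarMatrix.norm_def]
  refine ContinuousLinearMap.opNorm_le_bound _ zero_le_one fun v => ?_
  rw [one_mul, WithCStarModule.pi_norm, WithCStarModule.pi_norm]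
  refine Real.sqrt_le_sqrt ?_
  have := h v
  simpa [CStarMatrix.toCLM_apply_eq_sum, WithCStarModule.inner_def] using this

end RowTests

/-! ### Positivity of matrices, tested on rows. -/

section Positivity

section Abstract

variable {R : Type*} [CStarAlgebra R] [PartialOrder R] [StarOrderedRing R]

/-- Take `p = a⁻`: then `p a p = -(a⁻)³`, and `(a⁻)³ = 0` forces `a⁻ = 0`. The witness `p` exhibits
any failure of positivity. -/
theorem exists_negative_compression {a : R} (ha : IsSelfAdjoint a) :
    ∃ p d : R, star p = p ∧ p * a * p = -(star d * d) ∧ (d = 0 → 0 ≤ a) := by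
  have hsa : star (a⁻) = a⁻ := (CFC.negPart_nonneg a).isSelfAdjoint.star_eq
  have hneg : a⁻ * a * a⁻ = - (a⁻ * a⁻ * a⁻) := by
    calc a⁻ * a * a⁻ = a⁻ * (a⁺ - a⁻) * a⁻ := by rw [CFC.posPart_sub_negPart a ha]
      _ = _ := by rw [mul_sub, sub_mul, CFC.negPart_mul_posPart, zero_mul, zero_sub]
  obtain ⟨d, hd⟩ : ∃ d, a⁻ * a⁻ * a⁻ = star d * d := by
    have h0 : 0 ≤ a⁻ * a⁻ * a⁻ := by
      have := star_left_conjugate_nonneg (CFC.negPart_nonneg a) (a⁻)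
      rwa [hsa] at this
    exact CStarAlgebra.nonneg_iff_eq_star_mul_self.mp h0
  refine ⟨a⁻, d, hsa, by rw [hneg, hd], fun hd0 => ?_⟩
  have hcube : a⁻ * a⁻ * a⁻ = 0 := by rw [hd, hd0, mul_zero]
  have h4 : star (a⁻ * a⁻) * (a⁻ * a⁻) = 0 := by
    rw [star_mul, hsa, ← mul_assoc, hcube, zero_mul]
  have h5 : star (a⁻) * a⁻ = 0 := by
    rw [hsa]; exact (CStarRing.star_mul_self_eq_zero_iff _).mp h4
  exact (CFC.negPart_eq_zero_iff a ha).mp ((CStarRing.star_mul_self_eq_zero_iff _).mp h5)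

/-- Adding ε makes a positive element invertible, so its square root can be divided out on either
side of a corner. -/
theorem exists_sqrt_add_pos {a : R} (ha : 0 ≤ a) {ε : ℝ} (hε : 0 < ε) :
    ∃ r s : R, star r = r ∧ star s = s ∧ r * r = a + (ε : ℂ) • 1 ∧ r * s = 1 ∧ s * r = 1 := by
  have h1 : algebraMap ℝ R ε ≤ a + algebraMap ℝ R ε := le_add_of_nonneg_left ha
  have h0 : 0 ≤ a + algebraMap ℝ R ε := (algebraMap_nonneg R hε.le).trans h1
  have hu : IsUnit (a + algebraMap ℝ R ε) :=
    CStarAlgebra.isUnit_of_le _ h1 (by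
      rw [IsStrictlyPositive.iff_of_unital]
      exact ⟨algebraMap_nonneg R hε.le, (IsUnit.mk0 ε hε.ne').map _⟩)
  set r := CFC.sqrt (a + algebraMap ℝ R ε) with hr
  have hrr : r * r = a + algebraMap ℝ R ε := CFC.sqrt_mul_sqrt_self _ h0
  have hrs : star r = r := (CFC.sqrt_nonneg _).isSelfAdjoint.star_eq
  have hru : IsUnit r := by
    rw [← hrr] at hu
    exact (Commute.refl r).isUnit_mul_iff.mp hu |>.1
  obtain ⟨u, hu'⟩ := hru
  refine ⟨r, ↑u⁻¹, hrs, ?_, ?_, ?_, ?_⟩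
  · rw [← hu'] at hrs
    have : star u = u := Units.ext hrs
    rw [← Units.coe_star_inv, this]
  · rw [hrr, Algebra.algebraMap_eq_smul_one]
    simp
  · rw [← hu']; exact u.mul_inv
  · rw [← hu']; exact u.inv_mul

end Abstract

variable {n A M : Type*} [Fintype n] [DecidableEq n]
  [CStarAlgebra A] [PartialOrder A] [StarOrderedRing A]
  [CStarAlgebra M] [PartialOrder M] [StarOrderedRing M]

/-- A selfadjoint matrix whose row quadratic form is nonnegative is nonnegative. -/
theorem nonneg_of_rows (θ : A →⋆ₐ[ℂ] M) (hθ : Function.Injective θ) {a : CStarMatrix n n A}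
    (ha : IsSelfAdjoint a)
    (h : ∀ x : n → A, 0 ≤ θ (∑ i, ∑ j, x i * a i j * star (x j))) : 0 ≤ a := by
  -- The rows of `p` are the test rows: the diagonal entries of `p a p` are nonnegative by `h`, yet
  -- equal minus the sums of squares of the columns of `d`. Hence `d = 0`.
  obtain ⟨p, d, hsa, hneg, hd⟩ := exists_negative_compression ha
  have hentry : ∀ i, ∑ k, ∑ l, p i k * a k l * star (p i l) = - ∑ k, star (d k i) * d k i := by
    intro i
    have e := congrFun (congrFun hneg i) i
    rw [CStarMatrix.neg_apply, CStarMatrix.mul_apply (M := star d)] at e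
    simp only [CStarMatrix.star_apply] at e
    rw [← e, CStarMatrix.mul_apply]
    simp only [CStarMatrix.mul_apply, Finset.sum_mul]
    rw [Finset.sum_comm]
    refine Finset.sum_congr rfl fun l _ => Finset.sum_congr rfl fun k _ => ?_
    rw [← CStarMatrix.star_apply, hsa]
  refine hd ?_
  ext k i
  have h1 := h (p i)
  rw [hentry, map_neg, Left.nonneg_neg_iff] at h1
  have h2 : 0 ≤ ∑ k, star (d k i) * d k i := Finset.sum_nonneg fun k _ => star_mul_self_nonneg _
  have h3 : θ (∑ k, star (d k i) * d k i) = 0 := le_antisymm h1 (map_nonneg θ h2)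
  have hz := hθ (h3.trans (map_zero θ).symm)
  have := (Finset.sum_eq_zero_iff_of_nonneg fun k _ => star_mul_self_nonneg (d k i)).mp hz k
    (Finset.mem_univ k)
  exact (CStarRing.star_mul_self_eq_zero_iff _).mp this

end Positivity

/-! ### Extension of partially prescribed positive kernels. -/

section Extension

variable {J M : Type*} [CStarAlgebra M]

/-- The expression `∑ v i * y (i, j) * star (v j)` as a function of the matrix `y`. -/
noncomputable def rowForm (v : J → M) : (J × J →₀ M) →ₗ[ℝ] M :=
  Finsupp.lsum ℝ fun p => LinearMap.mulRight ℝ (star (v p.2)) ∘ₗ LinearMap.mulLeft ℝ (v p.1)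

theorem rowForm_apply (v : J → M) (y : J × J →₀ M) :
    rowForm v y = y.sum fun p m => v p.1 * m * star (v p.2) := rfl

@[simp]
theorem rowForm_single (v : J → M) (i j : J) (m : M) :
    rowForm v (Finsupp.single (i, j) m) = v i * m * star (v j) := by
  simp [rowForm_apply]

variable [PartialOrder M] [StarOrderedRing M]

/-- The cone of finitely supported matrices with nonnegative real part. -/
noncomputable def accretiveCone (J M : Type*) [CStarAlgebra M] [PartialOrder M]
    [StarOrderedRing M] : PointedCone ℝ (J × J →₀ M) where
  carrier := {y | ∀ v : J → M, 0 ≤ rowForm v y + star (rowForm v y)}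
  zero_mem' v := by simp
  add_mem' {x y} hx hy v := by
    have := add_nonneg (hx v) (hy v)
    rw [map_add, star_add]
    convert this using 1
    abel
  smul_mem' c y hy v := by
    have h : rowForm v (c • y) = (c : ℝ) • rowForm v y := map_smul (rowForm v) (c : ℝ) y
    rw [h, star_smul, star_trivial, ← smul_add]
    exact smul_nonneg c.2 (hy v)

/-- Complete the square: the real part is twice `(vᵢ + vⱼ m*)(vᵢ + vⱼ m*)* + vⱼ (‖m‖² - m* m) vⱼ*`.
The coefficient 2 on the corner compensates for the doubling of the diagonal in `x + x*`. -/
theorem single_add_single_add_single_mem_accretiveCone (i j : J) (m : M) :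
    (Finsupp.single (i, i) 1 + Finsupp.single (j, j) ((‖m‖ ^ 2) • 1) +
      Finsupp.single (i, j) ((2 : ℝ) • m) : J × J →₀ M) ∈ accretiveCone J M := by
  intro v
  have h1 : v j * (star m * m) * star (v j) ≤ (‖m‖ ^ 2) • (v j * star (v j)) := by
    have := star_right_conjugate_le_conjugate
      (CStarAlgebra.star_mul_le_algebraMap_norm_sq (a := m)) (v j)
    simpa [Algebra.algebraMap_eq_smul_one] using this
  have h2 : 0 ≤ (v i + v j * star m) * star (v i + v j * star m) := mul_star_self_nonneg _
  have h3 := add_nonneg h2 (sub_nonneg.mpr h1)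
  have h4 := add_nonneg h3 h3
  convert h4 using 1
  simp only [map_add, rowForm_single, star_add, star_mul, star_star, star_smul, star_trivial,
    mul_smul_comm, smul_mul_assoc, mul_one, two_smul, mul_add, add_mul,
    mul_assoc]
  abel

/-- This is the cofinality hypothesis of the Riesz extension theorem; each single entry is absorbed
by two diagonal scalars. -/
theorem exists_add_mem_accretiveCone (D : Submodule ℝ (J × J →₀ M))
    (hD : ∀ i, ∀ c : ℝ, Finsupp.single (i, i) (c • (1 : M)) ∈ D) (y : J × J →₀ M) :
    ∃ x ∈ D, x + y ∈ accretiveCone J M := by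
  induction y using Finsupp.induction_linear with
  | zero => exact ⟨0, D.zero_mem, by rw [add_zero]; exact zero_mem _⟩
  | add y z hy hz =>
    obtain ⟨x, hx, hxy⟩ := hy
    obtain ⟨x', hx', hxz⟩ := hz
    refine ⟨x + x', D.add_mem hx hx', ?_⟩
    rw [add_add_add_comm]
    exact add_mem hxy hxz
  | single p m =>
    obtain ⟨i, j⟩ := p
    refine ⟨_, D.add_mem (hD i 1) (hD j (‖(2⁻¹ : ℝ) • m‖ ^ 2)), ?_⟩
    have := single_add_single_add_single_mem_accretiveCone i j ((2⁻¹ : ℝ) • m)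
    rwa [smul_smul, mul_inv_cancel₀ two_ne_zero, one_smul, ← one_smul ℝ (1 : M), smul_smul,
      mul_one] at this

/-- A matrix of functionals which is positive where it is prescribed has a positive definite
extension. -/
theorem exists_positive_extension (N : J → J → Submodule ℂ M) (hN : ∀ i, 1 ∈ N i i)
    (Ψ : J → J → M →ₗ[ℂ] ℂ)
    (hΨ : ∀ y ∈ accretiveCone J M, (∀ i j, y (i, j) ∈ N i j) →
      0 ≤ (y.sum fun p m => Ψ p.1 p.2 m).re) :
    ∃ F : J → J → M →ₗ[ℂ] ℂ,
      (∀ i j, ∀ m ∈ N i j, F i j m = Ψ i j m) ∧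
      (∀ i j m, F j i (star m) = star (F i j m)) ∧
      ∀ v : J →₀ M, 0 ≤ (v.sum fun i a => v.sum fun j b => F i j (star a * b)).re := by
  let D : Submodule ℝ (J × J →₀ M) :=
    { carrier := {y | ∀ i j, y (i, j) ∈ N i j}
      zero_mem' := fun i j => (N i j).zero_mem
      add_mem' := fun hx hy i j => (N i j).add_mem (hx i j) (hy i j)
      smul_mem' := fun c y hy i j => ((N i j).restrictScalars ℝ).smul_mem c (hy i j) }
  have hDsingle : ∀ i j, ∀ m ∈ N i j, Finsupp.single (i, j) m ∈ D := by
    classical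
    intro i j m hm i' j'
    rw [Finsupp.single_apply]
    split_ifs with h
    · obtain ⟨rfl, rfl⟩ := Prod.ext_iff.mp h
      exact hm
    · exact (N i' j').zero_mem
  let f : (J × J →₀ M) →ₗ[ℝ] ℝ :=
    Finsupp.lsum ℝ fun p => Complex.reLm ∘ₗ (Ψ p.1 p.2).restrictScalars ℝ
  have hf : ∀ y, f y = (y.sum fun p m => Ψ p.1 p.2 m).re := by
    intro y
    simp [f, Finsupp.sum]
  -- Only the real part of the prescribed functional is extended; the complex functional is
  -- recovered from it afterwards.
  obtain ⟨g, hgf, hg⟩ := riesz_extension (accretiveCone J M) (f.toPMap D)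
    (fun x hx => by
      have := hΨ x hx x.2
      rwa [← hf] at this)
    (fun y => by
      obtain ⟨x, hx, hxy⟩ := exists_add_mem_accretiveCone D
        (fun i c => hDsingle i i _ (((N i i).restrictScalars ℝ).smul_mem c (hN i))) y
      exact ⟨⟨x, hx⟩, hxy⟩)
  let G : (J × J →₀ M) →ₗ[ℂ] ℂ := Module.Dual.extendRCLike (𝕜 := ℂ) g
  have hGre : ∀ y, (G y).re = g y := fun y => Module.Dual.re_extendRCLike_apply (𝕜 := ℂ) g y
  have hGim : ∀ y, (G y).im = -g (Complex.I • y) :=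
    fun y => Module.Dual.im_extendRCLike_apply (𝕜 := ℂ) g y
  -- A matrix with vanishing real part lies in the cone together with its negative, so `g` kills it.
  -- Hence the extension is Hermitian although the domain `D` need not be closed under adjoints.
  have hsymm : ∀ i j m, g (Finsupp.single (j, i) (star m)) = g (Finsupp.single (i, j) m) := by
    have key : ∀ i j m, 0 ≤ g (Finsupp.single (i, j) m - Finsupp.single (j, i) (star m)) := by
      intro i j m
      refine hg _ fun v => le_of_eq ?_
      simp only [map_sub, rowForm_single, star_sub, star_mul, star_star, mul_assoc]
      abel
    intro i j m
    have h1 := key i j m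
    have h2 := key j i (star m)
    rw [star_star, map_sub] at h2
    rw [map_sub] at h1
    linarith
  refine ⟨fun i j => G ∘ₗ Finsupp.lsingle (i, j), fun i j m hm => ?_, fun i j m => ?_,
    fun v => ?_⟩
  · have hgΨ : ∀ m ∈ N i j, g (Finsupp.single (i, j) m) = (Ψ i j m).re := by
      intro m hm
      refine (hgf ⟨_, hDsingle i j m hm⟩).trans ((hf _).trans ?_)
      simp
    apply Complex.ext
    · simp [hGre, hgΨ m hm]
    · rw [LinearMap.comp_apply, Finsupp.lsingle_apply, hGim, Finsupp.smul_single,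
        hgΨ _ ((N i j).smul_mem _ hm)]
      simp
  · apply Complex.ext
    · simp [hGre, hsymm]
    · have := hsymm i j (Complex.I • m)
      rw [star_smul] at this
      simp only [LinearMap.comp_apply, Finsupp.lsingle_apply, hGim, Finsupp.smul_single,
        Complex.star_def, Complex.conj_im]
      rw [← this]
      simp
  · let y : J × J →₀ M :=
      v.sum fun i a => v.sum fun j b => Finsupp.single (i, j) (star a * b)
    have hy : (v.sum fun i a => v.sum fun j b => (G ∘ₗ Finsupp.lsingle (i, j)) (star a * b)) =
        G y := by
      simp [y, Finsupp.sum, map_sum]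
    rw [hy, hGre]
    -- The matrix with entries `vᵢ* vⱼ` has row form `z z*` with `z = ∑ wᵢ vᵢ*`, hence lies in the
    -- cone.
    refine hg _ fun w => ?_
    have hw : rowForm w y =
        (v.sum fun i a => w i * star a) * star (v.sum fun i a => w i * star a) := by
      simp only [y, Finsupp.sum, map_sum, rowForm_single, Finset.sum_mul_sum, star_sum, star_mul,
        star_star, mul_assoc]
    rw [hw]
    have := mul_star_self_nonneg (v.sum fun i a => w i * star a)
    rw [(IsSelfAdjoint.of_nonneg this).star_eq]
    exact add_nonneg this this

end Extension

/-! ### The Kolmogorov decomposition of a positive kernel. -/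

section Kolmogorov

variable {J M : Type*} [CStarAlgebra M]

/-- The sesquilinear form on finitely supported families defined by a matrix of functionals. -/
noncomputable def kernelForm (F : J → J → M →ₗ[ℂ] ℂ) (v w : J →₀ M) : ℂ :=
  v.sum fun i a => w.sum fun j b => F i j (star a * b)

variable (F : J → J → M →ₗ[ℂ] ℂ)

@[simp]
theorem kernelForm_single (i j : J) (a b : M) :
    kernelForm F (Finsupp.single i a) (Finsupp.single j b) = F i j (star a * b) := by
  simp [kernelForm]

theorem kernelForm_add_left (u v w : J →₀ M) :
    kernelForm F (u + v) w = kernelForm F u w + kernelForm F v w := by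
  classical
  refine Finsupp.sum_add_index' (fun i => by simp [Finsupp.sum]) fun i a b => ?_
  simp [Finsupp.sum, add_mul, Finset.sum_add_distrib]

theorem kernelForm_smul_left (u w : J →₀ M) (c : ℂ) :
    kernelForm F (c • u) w = star c * kernelForm F u w := by
  rw [kernelForm, Finsupp.sum_smul_index' fun i => by simp [Finsupp.sum]]
  simp [kernelForm, Finsupp.sum, Finset.mul_sum]

theorem kernelForm_add_right (u v w : J →₀ M) :
    kernelForm F u (v + w) = kernelForm F u v + kernelForm F u w := by
  classical
  simp only [kernelForm]
  rw [← Finsupp.sum_add]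
  refine Finsupp.sum_congr fun i _ => ?_
  exact Finsupp.sum_add_index' (fun i => by simp) fun i a b => by simp [mul_add]

theorem kernelForm_smul_right (u w : J →₀ M) (c : ℂ) :
    kernelForm F u (c • w) = c * kernelForm F u w := by
  simp only [kernelForm, Finsupp.mul_sum]
  refine Finsupp.sum_congr fun i _ => ?_
  rw [Finsupp.sum_smul_index' fun i => by simp]
  simp

variable {F} in
theorem star_kernelForm (hF : ∀ i j m, F j i (star m) = star (F i j m)) (v w : J →₀ M) :
    star (kernelForm F v w) = kernelForm F w v := by
  simp only [kernelForm, Finsupp.sum, star_sum, ← hF, star_mul, star_star]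
  exact Finset.sum_comm

/-- Left multiplication on finitely supported families. -/
noncomputable def leftMul (m : M) : (J →₀ M) →ₗ[ℂ] J →₀ M :=
  Finsupp.mapRange.linearMap (LinearMap.mulLeft ℂ m)

@[simp]
theorem leftMul_single (m : M) (i : J) (a : M) :
    leftMul m (Finsupp.single i a) = Finsupp.single i (m * a) := by
  simp [leftMul]

@[simp]
theorem leftMul_apply (m : M) (v : J →₀ M) (i : J) : leftMul m v i = m * v i := by
  simp [leftMul]

theorem leftMul_mul (m m' : M) (v : J →₀ M) : leftMul (m * m') v = leftMul m (leftMul m' v) := by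
  ext; simp [mul_assoc]

theorem kernelForm_leftMul_right (m : M) (v w : J →₀ M) :
    kernelForm F v (leftMul m w) = kernelForm F (leftMul (star m) v) w := by
  simp only [kernelForm, leftMul, Finsupp.mapRange.linearMap_apply]
  rw [Finsupp.sum_mapRange_index fun i => by simp [Finsupp.sum]]
  refine Finsupp.sum_congr fun i _ => ?_
  rw [Finsupp.sum_mapRange_index fun i => by simp]
  simp [mul_assoc]

variable [PartialOrder M] [StarOrderedRing M]

-- Writing `‖m‖² - m* m = c* c`, the difference of the two sides is the form at `c v`. This makes
-- left multiplication bounded, so it extends to the completion.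
variable {F} in
theorem re_kernelForm_leftMul_le (hF : ∀ v, 0 ≤ (kernelForm F v v).re) (m : M) (v : J →₀ M) :
    (kernelForm F (leftMul m v) (leftMul m v)).re ≤ ‖m‖ ^ 2 * (kernelForm F v v).re := by
  obtain ⟨c, hc⟩ := CStarAlgebra.nonneg_iff_eq_star_mul_self.mp
    (sub_nonneg.mpr (CStarAlgebra.star_mul_le_algebraMap_norm_sq (a := m)))
  have h1 : leftMul (star m) (leftMul m v) + leftMul (star c) (leftMul c v) =
      ((‖m‖ ^ 2 : ℝ) : ℂ) • v := by
    ext i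
    rw [Finsupp.add_apply, ← leftMul_mul, ← leftMul_mul, leftMul_apply, leftMul_apply, ← add_mul,
      ← hc, add_sub_cancel, Finsupp.smul_apply, Algebra.algebraMap_eq_smul_one, smul_mul_assoc,
      one_mul, Complex.coe_smul]
  have h2 := kernelForm_add_right F v (leftMul (star m) (leftMul m v))
    (leftMul (star c) (leftMul c v))
  rw [h1, kernelForm_smul_right, kernelForm_leftMul_right F (star m) v (leftMul m v),
    kernelForm_leftMul_right F (star c) v (leftMul c v), star_star, star_star] at h2
  have h3 := congrArg Complex.re h2
  rw [Complex.re_ofReal_mul, Complex.add_re] at h3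
  linarith [hF (leftMul c v)]

end Kolmogorov

open UniformSpace Completion in
/-- The Kolmogorov decomposition of a positive definite matrix of functionals. -/
theorem exists_kolmogorov_decomposition {M : Type u} {J : Type v} [CStarAlgebra M]
    [PartialOrder M] [StarOrderedRing M] (F : J → J → M →ₗ[ℂ] ℂ)
    (hstar : ∀ i j m, F j i (star m) = star (F i j m))
    (hpos : ∀ v, 0 ≤ (kernelForm F v v).re) :
    ∃ (K : Type (max u v)) (_ : NormedAddCommGroup K) (_ : InnerProductSpace ℂ K)
      (_ : CompleteSpace K) (π : M →⋆ₐ[ℂ] (K →L[ℂ] K)) (e : J → K),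
      ∀ i j m, inner ℂ (e i) (π m (e j)) = F i j m := by
  let core : PreInnerProductSpace.Core ℂ (J →₀ M) :=
    { inner := kernelForm F
      conj_inner_symm := fun x y => star_kernelForm hstar y x
      re_inner_nonneg := hpos
      add_left := kernelForm_add_left F
      smul_left := kernelForm_smul_left F }
  let : SeminormedAddCommGroup (J →₀ M) :=
    InnerProductSpace.Core.toSeminormedAddCommGroup (c := core)
  let : InnerProductSpace ℂ (J →₀ M) := InnerProductSpace.ofCore core
  have hinner : ∀ x y : J →₀ M, inner ℂ x y = kernelForm F x y := fun _ _ => rfl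
  have hnorm : ∀ x : J →₀ M, ‖x‖ ^ 2 = (kernelForm F x x).re :=
    fun x => norm_sq_eq_re_inner (𝕜 := ℂ) x
  let L : M → (J →₀ M) →L[ℂ] J →₀ M := fun m => (leftMul m).mkContinuous ‖m‖ fun x => by
    rw [← sq_le_sq₀ (norm_nonneg _) (by positivity), mul_pow, hnorm, hnorm]
    exact re_kernelForm_leftMul_le hpos m x
  have hL : ∀ m x, L m x = leftMul m x := fun _ _ => rfl
  let π : M →⋆ₐ[ℂ] (Completion (J →₀ M) →L[ℂ] Completion (J →₀ M)) :=
    { toFun := fun m => (L m).completion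
      map_one' := by
        ext c
        induction c using induction_on with
        | hp => apply isClosed_eq <;> fun_prop
        | ih c =>
          rw [ContinuousLinearMap.completion_apply_coe, hL]
          congr 1
          ext
          simp
      map_mul' := fun m m' => by
        ext c
        induction c using induction_on with
        | hp => apply isClosed_eq <;> fun_prop
        | ih c =>
          rw [_root_.mul_apply_eq_comp, ContinuousLinearMap.completion_apply_coe,
            ContinuousLinearMap.completion_apply_coe, ContinuousLinearMap.completion_apply_coe,
            hL, hL, hL, leftMul_mul]
      map_zero' := by
        ext c
        induction c using induction_on with
        | hp => apply isClosed_eq <;> fun_prop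
        | ih c =>
          rw [ContinuousLinearMap.completion_apply_coe, hL]
          have : leftMul (0 : M) c = 0 := by ext; simp
          rw [this, Completion.coe_zero]
          rfl
      map_add' := fun m m' => by
        ext c
        induction c using induction_on with
        | hp => apply isClosed_eq <;> fun_prop
        | ih c =>
          rw [_root_.add_apply, ContinuousLinearMap.completion_apply_coe,
            ContinuousLinearMap.completion_apply_coe, ContinuousLinearMap.completion_apply_coe,
            hL, hL, hL, ← Completion.coe_add]
          congr 1
          ext
          simp [add_mul]
      commutes' := fun r => by
        ext c
        induction c using induction_on with
        | hp => apply isClosed_eq <;> fun_prop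
        | ih c =>
          rw [ContinuousLinearMap.completion_apply_coe, hL, Algebra.algebraMap_eq_smul_one,
            Algebra.algebraMap_eq_smul_one, _root_.smul_apply, _root_.one_apply_eq_self,
            ← Completion.coe_smul]
          congr 1
          ext
          simp
      map_star' := fun m => by
        rw [ContinuousLinearMap.star_eq_adjoint, ContinuousLinearMap.eq_adjoint_iff]
        intro x y
        induction x, y using induction_on₂ with
        | hp => apply isClosed_eq <;> fun_prop
        | ih x y =>
          rw [ContinuousLinearMap.completion_apply_coe, ContinuousLinearMap.completion_apply_coe,
            Completion.inner_coe, Completion.inner_coe, hL, hL, hinner, hinner,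
            kernelForm_leftMul_right] }
  refine ⟨Completion (J →₀ M), inferInstance, inferInstance, inferInstance, π,
    fun i => ((Finsupp.single i 1 : J →₀ M) : Completion (J →₀ M)), fun i j m => ?_⟩
  change inner ℂ _ ((L m).completion _) = _
  rw [ContinuousLinearMap.completion_apply_coe, Completion.inner_coe, hinner, hL, leftMul_single,
    kernelForm_single]
  simp

/-! ### Algebra of the pairing of rows through a matrix. -/

section RowPairing

variable {n M : Type*} [Fintype n] [Ring M] [StarRing M]

/-- The product of a row with a square matrix. -/
def rowMul (v : n → M) (P : CStarMatrix n n M) : n → M := fun j => ∑ i, v i * P i j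

/-- The product of a row, a square matrix and the adjoint of a row. -/
def rowPairing (v : n → M) (P : CStarMatrix n n M) (w : n → M) : M :=
  ∑ j, rowMul v P j * star (w j)

theorem rowPairing_eq_sum (v : n → M) (P : CStarMatrix n n M) (w : n → M) :
    rowPairing v P w = ∑ i, ∑ j, v i * P i j * star (w j) := by
  simp only [rowPairing, rowMul, Finset.sum_mul]
  exact Finset.sum_comm

theorem rowPairing_add (v : n → M) (P Q : CStarMatrix n n M) (w : n → M) :
    rowPairing v (P + Q) w = rowPairing v P w + rowPairing v Q w := by
  simp [rowPairing_eq_sum, mul_add, add_mul, Finset.sum_add_distrib]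

theorem rowPairing_sub (v : n → M) (P Q : CStarMatrix n n M) (w : n → M) :
    rowPairing v (P - Q) w = rowPairing v P w - rowPairing v Q w := by
  simp [rowPairing_eq_sum, mul_sub, sub_mul, Finset.sum_sub_distrib]

theorem rowPairing_smul [Algebra ℂ M] (c : ℂ) (v : n → M) (P : CStarMatrix n n M) (w : n → M) :
    rowPairing v (c • P) w = c • rowPairing v P w := by
  simp [rowPairing_eq_sum, Finset.smul_sum]

theorem rowPairing_neg_left (v : n → M) (P : CStarMatrix n n M) (w : n → M) :
    rowPairing (-v) P w = -rowPairing v P w := by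
  simp [rowPairing_eq_sum]

theorem rowPairing_neg_right (v : n → M) (P : CStarMatrix n n M) (w : n → M) :
    rowPairing v P (-w) = -rowPairing v P w := by
  simp [rowPairing_eq_sum]

theorem rowPairing_zero_left (P : CStarMatrix n n M) (w : n → M) : rowPairing 0 P w = 0 := by
  simp [rowPairing_eq_sum]

theorem rowPairing_zero_right (v : n → M) (P : CStarMatrix n n M) : rowPairing v P 0 = 0 := by
  simp [rowPairing_eq_sum]

theorem star_rowPairing (v : n → M) (P : CStarMatrix n n M) (w : n → M) :
    star (rowPairing v P w) = rowPairing w (star P) v := by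
  simp only [rowPairing_eq_sum, star_sum, star_mul, star_star, CStarMatrix.star_apply, mul_assoc]
  exact Finset.sum_comm

omit [StarRing M] in
theorem rowMul_mul (v : n → M) (P Q : CStarMatrix n n M) :
    rowMul v (P * Q) = rowMul (rowMul v P) Q := by
  ext j
  simp only [rowMul, CStarMatrix.mul_apply, Finset.mul_sum, Finset.sum_mul, mul_assoc]
  exact Finset.sum_comm

theorem rowPairing_rowMul_left (v : n → M) (S P : CStarMatrix n n M) (w : n → M) :
    rowPairing (rowMul v S) P w = rowPairing v (S * P) w := by
  simp only [rowPairing, rowMul_mul]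

theorem rowPairing_rowMul_right (v : n → M) (P S : CStarMatrix n n M) (w : n → M) :
    rowPairing v P (rowMul w S) = rowPairing v (P * star S) w := by
  rw [← star_star (rowPairing v P _), star_rowPairing, rowPairing_rowMul_left, star_rowPairing,
    star_mul, star_star]

variable [DecidableEq n]

theorem rowPairing_one (v w : n → M) : rowPairing v 1 w = ∑ j, v j * star (w j) := by
  simp [rowPairing, rowMul, CStarMatrix.one_apply]

end RowPairing

/-! ### Positivity of the prescribed data. -/

section MatrixPositivity

variable {n A M B H : Type*} [Fintype n]
  [CStarAlgebra A] [CStarAlgebra M] [NonUnitalCStarAlgebra B]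
  [NormedAddCommGroup H] [InnerProductSpace ℂ H] [CompleteSpace H]

theorem map_one_mul_map_mul_map_one [DecidableEq n] (θ : A →⋆ₐ[ℂ] M) (j : B →⋆ₙₐ[ℂ] M)
    (ρ : A →⋆ₙₐ[ℂ] (H →L[ℂ] H)) (Φ : B →ₗ[ℂ] (H →L[ℂ] H))
    (hmod : ∀ a b a' c, j c = θ a * j b * θ a' → Φ c = ρ a * Φ b * ρ a')
    (b : CStarMatrix n n B) :
    (1 : CStarMatrix n n A).map ρ * b.map Φ * (1 : CStarMatrix n n A).map ρ = b.map Φ := by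
  ext1 i k
  have := hmod 1 (b i k) 1 (b i k) (by simp)
  simp only [CStarMatrix.mul_apply, CStarMatrix.map_apply, CStarMatrix.one_apply, apply_ite ρ,
    map_zero, ite_mul, mul_ite, zero_mul, mul_zero, Finset.sum_ite_eq, Finset.sum_ite_eq',
    Finset.mem_univ, if_true]
  exact this.symm

/-- A matrix `s b s'` with `s`, `s'` over `A` and `b` over the ideal `B`. -/
theorem exists_matrix_conjugate (θ : A →⋆ₐ[ℂ] M) (j : B →⋆ₙₐ[ℂ] M)
    (ρ : A →⋆ₙₐ[ℂ] (H →L[ℂ] H)) (Φ : B →ₗ[ℂ] (H →L[ℂ] H))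
    (hideal : ∀ a b a', ∃ c, j c = θ a * j b * θ a')
    (hmod : ∀ a b a' c, j c = θ a * j b * θ a' → Φ c = ρ a * Φ b * ρ a')
    (s s' : CStarMatrix n n A) (b : CStarMatrix n n B) :
    ∃ c : CStarMatrix n n B, c.map j = s.map θ * b.map j * s'.map θ ∧
      c.map Φ = s.map ρ * b.map Φ * s'.map ρ := by
  choose t ht using hideal
  refine ⟨CStarMatrix.ofMatrix fun i l => ∑ m, ∑ k, t (s i k) (b k m) (s' m l), ?_, ?_⟩
  · ext1 i l
    change j (∑ m, ∑ k, t (s i k) (b k m) (s' m l)) = _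
    simp only [CStarMatrix.map_apply, CStarMatrix.mul_apply, map_sum, ht, Finset.sum_mul]
  · ext1 i l
    change Φ (∑ m, ∑ k, t (s i k) (b k m) (s' m l)) = _
    simp only [CStarMatrix.map_apply, CStarMatrix.mul_apply, map_sum,
      fun a b a' => hmod a b a' _ (ht a b a'), Finset.sum_mul]

variable [DecidableEq n] [PartialOrder A] [StarOrderedRing A] [PartialOrder M] [StarOrderedRing M]
  [PartialOrder B] [StarOrderedRing B]

/-- Positivity of a two by two block matrix bounds its corner: conjugating by `s` and `s'` shrinks
the diagonal blocks below 1, which leaves a contraction in the corner. -/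
theorem norm_conjugate_le_one (θ : A →⋆ₐ[ℂ] M) (j : B →⋆ₙₐ[ℂ] M) (hj : Function.Injective j)
    {ε : ℝ} (hε : 0 < ε) {a a' r s r' s' : CStarMatrix n n A} {b c : CStarMatrix n n B}
    (hs : star s = s) (hr : r * r = a + (ε : ℂ) • 1) (hrs : r * s = 1) (hsr : s * r = 1)
    (hs' : star s' = s') (hr' : r' * r' = a' + (ε : ℂ) • 1) (hrs' : r' * s' = 1)
    (hsr' : s' * r' = 1) (hc : c.map j = s.map θ * b.map j * s'.map θ)
    (h : ∀ v w : n → M, 0 ≤ rowPairing v (a.map θ) v + rowPairing w (a'.map θ) w +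
      (rowPairing v (b.map j) w + star (rowPairing v (b.map j) w))) : ‖c‖ ≤ 1 := by
  refine norm_le_one_of_rows fun x => ?_
  let Θ := CStarMatrix.mapₙₐ (n := n) (θ : A →⋆ₙₐ[ℂ] M)
  have hΘ : ∀ a, Θ a = a.map θ := fun _ => rfl
  have hΘ1 : Θ 1 = 1 := by
    ext1 i k
    simp [hΘ, CStarMatrix.one_apply, apply_ite θ]
  set X : n → M := fun i => j (x i) with hX
  set W : n → M := rowMul X (c.map j) with hW
  -- Since `s = r⁻¹`, one has `s a s = 1 - ε s s*`, which is at most 1.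
  have key : ∀ {a r s : CStarMatrix n n A}, star s = s → r * r = a + (ε : ℂ) • 1 → r * s = 1 →
      s * r = 1 → ∀ Y : n → M, rowPairing (rowMul Y (Θ s)) (a.map θ) (rowMul Y (Θ s)) ≤
        ∑ i, Y i * star (Y i) := by
    intro a r s hs hr hrs hsr Y
    have ha : a = r * r - (ε : ℂ) • 1 := by rw [hr, add_sub_cancel_right]
    have e1 : Θ s * Θ a * Θ s = 1 - (ε : ℂ) • (Θ s * star (Θ s)) := by
      rw [← map_star, hs, ← map_mul, ← map_mul, ha, ← hΘ1, ← map_mul, ← map_smul, ← map_sub]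
      congr 1
      rw [mul_sub, sub_mul, ← mul_assoc, hsr, one_mul, hrs, CStarMatrix.mul_smul,
        CStarMatrix.smul_mul, mul_one]
    rw [rowPairing_rowMul_left, rowPairing_rowMul_right, ← hΘ, ← map_star Θ s, hs, e1,
      rowPairing_sub, rowPairing_one, rowPairing_smul, ← mul_one (Θ s), mul_assoc,
      ← rowPairing_rowMul_left, mul_one, one_mul, ← one_mul (star (Θ s)),
      ← rowPairing_rowMul_right, rowPairing_one]
    refine sub_le_self _ ?_
    rw [Complex.coe_smul]
    exact smul_nonneg hε.le (Finset.sum_nonneg fun i _ => mul_star_self_nonneg _)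
  -- With `W = X c`, these rows make the cross terms `-2 W W*`, so that `0 ≤ X X* + W W* - 2 W W*`.
  have h1 := h (rowMul X (Θ s)) (-rowMul W (Θ s'))
  have h2 := key hs hr hrs hsr X
  have h3 := key hs' hr' hrs' hsr' W
  have h4 : rowPairing (rowMul X (Θ s)) (b.map j) (-rowMul W (Θ s')) =
      - ∑ i, W i * star (W i) := by
    rw [rowPairing_neg_right, rowPairing_rowMul_left, rowPairing_rowMul_right, ← map_star, hs', hΘ,
      hΘ, ← hc, ← mul_one (c.map j), ← rowPairing_rowMul_left, rowPairing_one]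
  have h5 : star (∑ i, W i * star (W i)) = ∑ i, W i * star (W i) := by simp
  rw [h4, star_neg, h5, rowPairing_neg_left, rowPairing_neg_right, neg_neg] at h1
  have h6 : ∑ i, W i * star (W i) ≤ ∑ i, X i * star (X i) := by
    have h7 := h1.trans (add_le_add_left (add_le_add h2 h3) _)
    rw [← sub_nonneg]
    convert h7 using 1
    abel
  have hWj : ∀ k, W k = j (∑ i, x i * c i k) := fun k => by simp [hW, rowMul, hX]
  have h8 : j (∑ k, (∑ i, x i * c i k) * star (∑ i, x i * c i k)) ≤
      j (∑ i, x i * star (x i)) := by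
    simp only [hWj, hX] at h6
    rw [map_sum, map_sum]
    simp only [map_mul j, map_star j]
    exact h6
  have h9 := CStarAlgebra.norm_le_norm_of_nonneg_of_le (by
    refine map_nonneg j (Finset.sum_nonneg fun i _ => mul_star_self_nonneg _)) h8
  rwa [NonUnitalStarAlgHom.norm_map j hj, NonUnitalStarAlgHom.norm_map j hj] at h9

theorem nonneg_real_part_of_rows (θ : A →⋆ₐ[ℂ] M) (hθ : Function.Injective θ)
    {a : CStarMatrix n n A}
    (h : ∀ v : n → M, 0 ≤ rowPairing v (a.map θ) v + star (rowPairing v (a.map θ) v)) :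
    0 ≤ a + star a := by
  refine nonneg_of_rows θ hθ (IsSelfAdjoint.add_star_self a) fun x => ?_
  have e : θ (∑ i, ∑ k, x i * (a + star a) i k * star (x k)) =
      rowPairing (fun i => θ (x i)) (a.map θ) (fun i => θ (x i)) +
        star (rowPairing (fun i => θ (x i)) (a.map θ) (fun i => θ (x i))) := by
    rw [star_rowPairing, ← rowPairing_add, rowPairing_eq_sum]
    simp [map_star, CStarMatrix.star_apply]
  rw [e]
  exact h _

/-- Complete boundedness and the bimodule property meet here: the corner is factored through a
contraction over `B`, and only the outer factors, which come from `A`, see the vectors. -/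
theorem re_inner_nonneg_of_rows (θ : A →⋆ₐ[ℂ] M) (hθ : Function.Injective θ) (j : B →⋆ₙₐ[ℂ] M)
    (hj : Function.Injective j) (ρ : A →⋆ₙₐ[ℂ] (H →L[ℂ] H)) (Φ : B →ₗ[ℂ] (H →L[ℂ] H))
    (hideal : ∀ a b a', ∃ c, j c = θ a * j b * θ a')
    (hmod : ∀ a b a' c, j c = θ a * j b * θ a' → Φ c = ρ a * Φ b * ρ a')
    {κ : ℝ} (hκ : 0 ≤ κ) (hcb : ∀ c : CStarMatrix n n B, ‖c‖ ≤ 1 → ‖c.map Φ‖ ≤ κ)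
    (a a' : CStarMatrix n n A) (b : CStarMatrix n n B)
    (h : ∀ v w : n → M, 0 ≤ (rowPairing v (a.map θ) v + rowPairing w (a'.map θ) w +
      rowPairing v (b.map j) w) + star (rowPairing v (a.map θ) v + rowPairing w (a'.map θ) w +
      rowPairing v (b.map j) w)) (ξ ξ' : PiLp 2 (fun _ : n => H)) :
    0 ≤ κ * (inner ℂ ξ (matrixOperator (a.map ρ) ξ)).re +
      κ * (inner ℂ ξ' (matrixOperator (a'.map ρ) ξ')).re +
      (inner ℂ ξ (matrixOperator (b.map Φ) ξ')).re := by
  have ha : 0 ≤ a + star a := nonneg_real_part_of_rows θ hθ fun v => by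
    simpa [rowPairing_zero_left, rowPairing_zero_right] using h v 0
  have ha' : 0 ≤ a' + star a' := nonneg_real_part_of_rows θ hθ fun v => by
    simpa [rowPairing_zero_left, rowPairing_zero_right] using h 0 v
  have h' : ∀ v w : n → M, 0 ≤ rowPairing v ((a + star a).map θ) v +
      rowPairing w ((a' + star a').map θ) w +
      (rowPairing v (b.map j) w + star (rowPairing v (b.map j) w)) := by
    intro v w
    have e : ∀ x : CStarMatrix n n A, (x + star x).map θ = x.map θ + star (x.map θ) := by
      intro x
      ext1 i k
      simp [CStarMatrix.star_apply, map_star]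
    have := h v w
    simp only [star_add, star_rowPairing] at this
    rw [e, e, rowPairing_add, rowPairing_add, star_rowPairing]
    convert this using 1
    abel
  let R : CStarMatrix n n A →⋆ₙₐ[ℂ] _ :=
    (matrixOperatorHom (n := n) (H := H)).comp (CStarMatrix.mapₙₐ ρ)
  have hR : ∀ x, R x = matrixOperator (x.map ρ) := fun _ => rfl
  have hRre : ∀ (x : CStarMatrix n n A) (η : PiLp 2 (fun _ : n => H)),
      (inner ℂ η (R (x + star x) η)).re = 2 * (inner ℂ η (R x η)).re := by
    intro x η
    rw [map_add, map_star, _root_.add_apply, inner_add_right, Complex.add_re,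
      ContinuousLinearMap.star_eq_adjoint, ContinuousLinearMap.adjoint_inner_right,
      ← inner_conj_symm (𝕜 := ℂ) (R x η), Complex.conj_re]
    ring
  set p := (inner ℂ ξ (R 1 ξ)).re with hp
  set p' := (inner ℂ ξ' (R 1 ξ')).re with hp'
  set E := κ * (inner ℂ ξ (matrixOperator (a.map ρ) ξ)).re +
      κ * (inner ℂ ξ' (matrixOperator (a'.map ρ) ξ')).re +
      (inner ℂ ξ (matrixOperator (b.map Φ) ξ')).re with hE
  have main : ∀ ε : ℝ, 0 < ε → -(ε * (κ * (p + p'))) ≤ 2 * E := by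
    intro ε hε
    obtain ⟨r, s, hrst, hs, hr, hrs, hsr⟩ := exists_sqrt_add_pos ha hε
    obtain ⟨r', s', hrst', hs', hr', hrs', hsr'⟩ := exists_sqrt_add_pos ha' hε
    obtain ⟨c, hcj, hcΦ⟩ := exists_matrix_conjugate θ j ρ Φ hideal hmod s s' b
    have hc := norm_conjugate_le_one θ j hj hε hs hr hrs hsr hs' hr' hrs' hsr' hcj h'
    have hcn := hcb c hc
    rw [← norm_matrixOperator] at hcn
    -- As ρ need not be unital, `R 1` may differ from the identity; it is absorbed by `Φ` and then
    -- split as `R r * R s` on the left and `R s' * R r'` on the right.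
    have hb : matrixOperator (b.map Φ) = R r * matrixOperator (c.map Φ) * R r' := by
      rw [← map_one_mul_map_mul_map_one θ j ρ Φ hmod b, hR, hR, hcΦ, ← matrixOperatorHom_apply,
        ← matrixOperatorHom_apply, ← matrixOperatorHom_apply, ← matrixOperatorHom_apply,
        ← map_mul, ← map_mul]
      congr 1
      change CStarMatrix.mapₙₐ ρ 1 * _ * CStarMatrix.mapₙₐ ρ 1 = CStarMatrix.mapₙₐ ρ r *
        (CStarMatrix.mapₙₐ ρ s * b.map Φ * CStarMatrix.mapₙₐ ρ s') * CStarMatrix.mapₙₐ ρ r'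
      nth_rw 1 [← hrs]
      rw [← hsr', map_mul, map_mul]
      simp only [mul_assoc]
    have hsq : ∀ {x r : CStarMatrix n n A} (η : PiLp 2 (fun _ : n => H)), star r = r →
        r * r = (x + star x) + (ε : ℂ) • 1 →
        ‖R r η‖ ^ 2 = 2 * (inner ℂ η (R x η)).re + ε * (inner ℂ η (R 1 η)).re := by
      intro x r η hrst hr
      rw [← hRre, norm_sq_eq_re_inner (𝕜 := ℂ), ← ContinuousLinearMap.adjoint_inner_right,
        ← ContinuousLinearMap.star_eq_adjoint, ← map_star, hrst, ← _root_.mul_apply_eq_comp,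
        ← map_mul, hr, map_add R, map_smul, _root_.add_apply, inner_add_right, _root_.smul_apply,
        inner_smul_right, RCLike.re_eq_complex_re, Complex.add_re, Complex.re_ofReal_mul]
    have hcross : -(κ * ‖R r ξ‖ * ‖R r' ξ'‖) ≤ (inner ℂ ξ (matrixOperator (b.map Φ) ξ')).re := by
      rw [hb, mul_assoc (R r), _root_.mul_apply_eq_comp (R r),
        ← ContinuousLinearMap.adjoint_inner_left, ← ContinuousLinearMap.star_eq_adjoint,
        ← map_star, hrst, _root_.mul_apply_eq_comp]
      have h1 := (Complex.abs_re_le_norm _).trans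
        (norm_inner_le_norm (𝕜 := ℂ) (R r ξ) (matrixOperator (c.map Φ) (R r' ξ')))
      have h2 : ‖matrixOperator (c.map Φ) (R r' ξ')‖ ≤ κ * ‖R r' ξ'‖ :=
        (matrixOperator (c.map Φ)).le_of_opNorm_le hcn _
      have h3 := mul_le_mul_of_nonneg_left h2 (norm_nonneg (R r ξ))
      have h4 := neg_abs_le (inner ℂ (R r ξ) (matrixOperator (c.map Φ) (R r' ξ'))).re
      linarith
    have e1 := hsq ξ hrst hr
    have e2 := hsq ξ' hrst' hr'
    rw [← hp] at e1
    rw [← hp'] at e2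
    -- The arithmetic–geometric inequality replaces the product of norms by squares, which `hsq`
    -- evaluates.
    have h5 := mul_nonneg hκ (sq_nonneg (‖R r ξ‖ - ‖R r' ξ'‖))
    rw [sub_sq, e1, e2] at h5
    rw [hE, ← hR, ← hR]
    linarith
  by_contra! hneg
  have hpos : 0 < |κ * (p + p')| + 1 := by positivity
  -- This ε makes the error at most `-E`, so `E ≤ 2 * E`, against `E < 0`; the summand 1 avoids
  -- division by zero.
  have h1 := main (-E / (|κ * (p + p')| + 1)) (div_pos (neg_pos.mpr hneg) hpos)
  have h2 : -E / (|κ * (p + p')| + 1) * (κ * (p + p')) ≤ -E := by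
    rw [div_mul_eq_mul_div, div_le_iff₀ hpos]
    exact mul_le_mul_of_nonneg_left ((le_abs_self _).trans (by linarith)) (by linarith)
  linarith

end MatrixPositivity

/-! ### The partial kernel on two copies of `H`. -/

section Blocks

theorem ofMatrix_entry {m n X : Type*} (f : m → n → X) (i : m) (k : n) :
    CStarMatrix.ofMatrix f i k = f i k := rfl

theorem finsupp_sum_blocks {α M X : Type*} [AddCommMonoid M] [AddCommMonoid X]
    (y : (α ⊕ α) × (α ⊕ α) →₀ M) (L : Finset α)
    (hL : y.support ⊆ L.disjSum L ×ˢ L.disjSum L) (f : (α ⊕ α) × (α ⊕ α) → M → X)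
    (hf : ∀ p, f p 0 = 0) :
    y.sum f = ∑ i : L, ∑ k : L, (f (.inl i, .inl k) (y (.inl i, .inl k)) +
      f (.inl i, .inr k) (y (.inl i, .inr k)) + f (.inr i, .inl k) (y (.inr i, .inl k)) +
      f (.inr i, .inr k) (y (.inr i, .inr k))) := by
  rw [Finsupp.sum_of_support_subset y hL f fun p _ => hf p, Finset.sum_product,
    Finset.sum_disjSum]
  simp only [Finset.sum_disjSum]
  rw [← Finset.sum_coe_sort L, ← Finset.sum_coe_sort L, ← Finset.sum_add_distrib]
  refine Finset.sum_congr rfl fun i _ => ?_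
  rw [← Finset.sum_coe_sort L, ← Finset.sum_coe_sort L, ← Finset.sum_coe_sort L,
    ← Finset.sum_coe_sort L, ← Finset.sum_add_distrib, ← Finset.sum_add_distrib,
    ← Finset.sum_add_distrib]
  refine Finset.sum_congr rfl fun k _ => ?_
  abel

theorem exists_support_subset_disjSum {α M : Type*} [Zero M] (y : (α ⊕ α) × (α ⊕ α) →₀ M) :
    ∃ L : Finset α, y.support ⊆ L.disjSum L ×ˢ L.disjSum L := by
  classical
  refine ⟨y.support.image (fun p => Sum.elim id id p.1) ∪
    y.support.image (fun p => Sum.elim id id p.2), fun p hp => ?_⟩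
  have h1 := Finset.mem_union_left (y.support.image (fun p => Sum.elim id id p.2))
    (Finset.mem_image_of_mem (fun p : (α ⊕ α) × (α ⊕ α) => Sum.elim id id p.1) hp)
  have h2 := Finset.mem_union_right (y.support.image (fun p => Sum.elim id id p.1))
    (Finset.mem_image_of_mem (fun p : (α ⊕ α) × (α ⊕ α) => Sum.elim id id p.2) hp)
  obtain ⟨p1, p2⟩ := p
  rw [Finset.mem_product]
  constructor
  · cases p1 with
    | inl x => exact Finset.inl_mem_disjSum.mpr h1
    | inr x => exact Finset.inr_mem_disjSum.mpr h1
  · cases p2 with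
    | inl x => exact Finset.inl_mem_disjSum.mpr h2
    | inr x => exact Finset.inr_mem_disjSum.mpr h2

variable {A M B H : Type*} [CStarAlgebra A] [CStarAlgebra M] [NonUnitalCStarAlgebra B]
  [NormedAddCommGroup H] [InnerProductSpace ℂ H]

/-- The functional `m ↦ ⟪h, T m k⟫`. -/
noncomputable def coefficient (T : M →ₗ[ℂ] (H →L[ℂ] H)) (h k : H) : M →ₗ[ℂ] ℂ where
  toFun m := inner ℂ h (T m k)
  map_add' m m' := by simp
  map_smul' c m := by simp

@[simp]
theorem coefficient_apply (T : M →ₗ[ℂ] (H →L[ℂ] H)) (h k : H) (m : M) :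
    coefficient T h k m = inner ℂ h (T m k) := rfl

/-- The functionals `κ ⟪h, R(·) k⟫` on the diagonal blocks and `⟪h, P(·) k⟫` on the upper corner. -/
noncomputable def blockFunctional (κ : ℝ) (R P : M →ₗ[ℂ] (H →L[ℂ] H)) :
    H ⊕ H → H ⊕ H → M →ₗ[ℂ] ℂ
  | .inl h, .inl k => (κ : ℂ) • coefficient R h k
  | .inl h, .inr k => coefficient P h k
  | .inr _, .inl _ => 0
  | .inr h, .inr k => (κ : ℂ) • coefficient R h k

/-- The subspaces where the functionals of `blockFunctional` are prescribed. -/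
noncomputable def blockSubspace (H : Type*) (θ : A →⋆ₐ[ℂ] M) (j : B →⋆ₙₐ[ℂ] M) :
    H ⊕ H → H ⊕ H → Submodule ℂ M
  | .inl _, .inl _ => LinearMap.range (θ.toAlgHom.toLinearMap)
  | .inl _, .inr _ => LinearMap.range (j : B →ₗ[ℂ] M)
  | .inr _, .inl _ => ⊥
  | .inr _, .inr _ => LinearMap.range (θ.toAlgHom.toLinearMap)

variable [CompleteSpace H] [PartialOrder A] [StarOrderedRing A] [PartialOrder M] [StarOrderedRing M]
  [PartialOrder B] [StarOrderedRing B]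

/-- A finitely supported matrix involves finitely many vectors of `H`; listing these as one vector ξ
of `Hⁿ` turns the sum into the matrix estimate. The lower corner can be left zero since only real
parts matter. -/
theorem re_sum_blockFunctional_nonneg (θ : A →⋆ₐ[ℂ] M) (hθ : Function.Injective θ)
    (j : B →⋆ₙₐ[ℂ] M) (hj : Function.Injective j) (ρ : A →⋆ₙₐ[ℂ] (H →L[ℂ] H))
    (Φ : B →ₗ[ℂ] (H →L[ℂ] H))
    (hideal : ∀ a b a', ∃ c, j c = θ a * j b * θ a')
    (hmod : ∀ a b a' c, j c = θ a * j b * θ a' → Φ c = ρ a * Φ b * ρ a')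
    {κ : ℝ} (hκ : 0 ≤ κ)
    (hcb : ∀ (L : Finset H) (c : CStarMatrix L L B), ‖c‖ ≤ 1 → ‖c.map Φ‖ ≤ κ)
    (R P : M →ₗ[ℂ] (H →L[ℂ] H)) (hR : ∀ a, R (θ a) = ρ a) (hP : ∀ b, P (j b) = Φ b)
    (y : (H ⊕ H) × (H ⊕ H) →₀ M) (hy : y ∈ accretiveCone (H ⊕ H) M)
    (hyN : ∀ p q, y (p, q) ∈ blockSubspace H θ j p q) :
    0 ≤ (y.sum fun p m => blockFunctional κ R P p.1 p.2 m).re := by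
  classical
  obtain ⟨L, hL⟩ := exists_support_subset_disjSum y
  have h11 : ∀ i k : L, ∃ a, θ a = y (.inl i, .inl k) := fun i k => hyN (.inl i) (.inl k)
  have h22 : ∀ i k : L, ∃ a, θ a = y (.inr i, .inr k) := fun i k => hyN (.inr i) (.inr k)
  have h12 : ∀ i k : L, ∃ b, j b = y (.inl i, .inr k) := fun i k => hyN (.inl i) (.inr k)
  have h21 : ∀ i k : L, y (.inr i, .inl k) = 0 := fun i k => hyN (.inr i) (.inl k)
  choose a ha using h11
  choose a' ha' using h22
  choose b hb using h12
  let ξ : PiLp 2 (fun _ : L => H) := WithLp.toLp 2 fun i => (i : H)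
  have key := re_inner_nonneg_of_rows θ hθ j hj ρ Φ hideal hmod hκ (hcb L)
    (CStarMatrix.ofMatrix a) (CStarMatrix.ofMatrix a') (CStarMatrix.ofMatrix b) (fun v w => by
      -- The rows `v` and `w` are extended by zero outside `L`, giving one test row for membership
      -- in the cone.
      have e : rowPairing v ((CStarMatrix.ofMatrix a).map θ) v +
          rowPairing w ((CStarMatrix.ofMatrix a').map θ) w +
          rowPairing v ((CStarMatrix.ofMatrix b).map j) w =
          rowForm (Sum.elim (fun h => if hh : h ∈ L then v ⟨h, hh⟩ else 0)
            (fun h => if hh : h ∈ L then w ⟨h, hh⟩ else 0)) y := by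
        rw [rowForm_apply, finsupp_sum_blocks y L hL _ (fun p => by simp)]
        rw [rowPairing_eq_sum, rowPairing_eq_sum, rowPairing_eq_sum, ← Finset.sum_add_distrib,
          ← Finset.sum_add_distrib]
        refine Finset.sum_congr rfl fun i _ => ?_
        rw [← Finset.sum_add_distrib, ← Finset.sum_add_distrib]
        refine Finset.sum_congr rfl fun k _ => ?_
        simp only [CStarMatrix.map_apply, ofMatrix_entry, Sum.elim_inl, Sum.elim_inr,
          h21, Subtype.coe_eta, Finset.coe_mem, dif_pos, mul_zero, zero_mul, add_zero, ← ha,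
          ← ha', ← hb]
        abel
      rw [e]
      exact hy _) ξ ξ
  rw [finsupp_sum_blocks y L hL _ (fun p => map_zero _)]
  rw [← Complex.re_ofReal_mul, ← Complex.re_ofReal_mul, ← Complex.add_re, ← Complex.add_re] at key
  convert key using 2
  rw [inner_matrixOperator, inner_matrixOperator, inner_matrixOperator, Finset.mul_sum,
    Finset.mul_sum, ← Finset.sum_add_distrib, ← Finset.sum_add_distrib]
  refine Finset.sum_congr rfl fun i _ => ?_
  rw [Finset.mul_sum, Finset.mul_sum, ← Finset.sum_add_distrib, ← Finset.sum_add_distrib]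
  refine Finset.sum_congr rfl fun k _ => ?_
  simp only [h21, ← ha, ← ha', ← hb, blockFunctional, LinearMap.smul_apply, coefficient_apply, hR,
    hP, map_zero, smul_eq_mul, CStarMatrix.map_apply, ofMatrix_entry, ξ]
  ring

end Blocks

/-! ### From Gram relations to intertwining operators. -/

section Intertwiners

variable {H K : Type*} [NormedAddCommGroup H] [InnerProductSpace ℂ H]
  [NormedAddCommGroup K] [InnerProductSpace ℂ K]

/-- A map whose Gram kernel is sesquilinear is itself linear: the squared norm of `e (h + k) - (e h
+ e k)` expands to zero, and likewise for scalars. -/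
theorem exists_continuousLinearMap_of_inner (e : H → K) (Q : H →L[ℂ] H) (hQ : ‖Q‖ ≤ 1) {κ : ℝ}
    (hκ : 0 ≤ κ) (he : ∀ h k, inner ℂ (e h) (e k) = κ * inner ℂ h (Q k)) :
    ∃ S : H →L[ℂ] K, (∀ h, S h = e h) ∧ ‖S‖ ≤ √κ := by
  let S : H →ₗ[ℂ] K :=
    { toFun := e
      map_add' := fun h k => by
        rw [← sub_eq_zero, ← inner_self_eq_zero (𝕜 := ℂ)]
        simp only [inner_sub_left, inner_sub_right, inner_add_left, inner_add_right, he, map_add]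
        ring
      map_smul' := fun c h => by
        rw [← sub_eq_zero, ← inner_self_eq_zero (𝕜 := ℂ)]
        simp only [inner_sub_left, inner_sub_right, inner_smul_left, inner_smul_right, he,
          map_smul, RingHom.id_apply]
        ring }
  have hS : ∀ h, ‖S h‖ ≤ √κ * ‖h‖ := by
    intro h
    rw [← sq_le_sq₀ (norm_nonneg _) (by positivity), mul_pow, Real.sq_sqrt hκ,
      norm_sq_eq_re_inner (𝕜 := ℂ)]
    change (inner ℂ (e h) (e h)).re ≤ _
    rw [he, Complex.re_ofReal_mul]
    refine mul_le_mul_of_nonneg_left ?_ hκ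
    calc (inner ℂ h (Q h)).re ≤ ‖h‖ * ‖Q h‖ := re_inner_le_norm (𝕜 := ℂ) h (Q h)
      _ ≤ ‖h‖ * ‖h‖ := by
        gcongr
        simpa using Q.le_of_opNorm_le hQ h
      _ = ‖h‖ ^ 2 := (sq _).symm
  exact ⟨S.mkContinuous (√κ) hS, fun _ => rfl, S.mkContinuous_norm_le (Real.sqrt_nonneg _) hS⟩

end Intertwiners

theorem exists_bimodule_dilation {A B : Type*} {M : Type u} {H : Type v}
    [CStarAlgebra A] [PartialOrder A] [StarOrderedRing A]
    [CStarAlgebra M] [PartialOrder M] [StarOrderedRing M]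
    [NonUnitalCStarAlgebra B] [PartialOrder B] [StarOrderedRing B]
    [NormedAddCommGroup H] [InnerProductSpace ℂ H] [CompleteSpace H]
    (θ : A →⋆ₐ[ℂ] M) (hθ : Function.Injective θ)
    (j : B →⋆ₙₐ[ℂ] M) (hj : Function.Injective j) (ρ : A →⋆ₙₐ[ℂ] (H →L[ℂ] H))
    (Φ : B →ₗ[ℂ] (H →L[ℂ] H))
    (hideal : ∀ a b a', ∃ c, j c = θ a * j b * θ a')
    (hmod : ∀ a b a' c, j c = θ a * j b * θ a' → Φ c = ρ a * Φ b * ρ a')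
    {κ : ℝ} (hκ : 0 ≤ κ)
    (hcb : ∀ (L : Finset H) (c : CStarMatrix L L B), ‖c‖ ≤ 1 → ‖c.map Φ‖ ≤ κ) :
    ∃ (K : Type (max u v)) (_ : NormedAddCommGroup K) (_ : InnerProductSpace ℂ K)
      (_ : CompleteSpace K) (π : M →⋆ₐ[ℂ] (K →L[ℂ] K)) (S T : H →L[ℂ] K),
      (∀ a ξ, S (ρ a ξ) = π (θ a) (S ξ)) ∧ (∀ a ξ, T (ρ a ξ) = π (θ a) (T ξ)) ∧
      (∀ b, Φ b = ContinuousLinearMap.adjoint S ∘L π (j b) ∘L T) ∧ ‖S‖ ≤ √κ ∧ ‖T‖ ≤ √κ := by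
  -- Arbitrary linear left inverses extend ρ and `Φ` to all of `M`; only the values on the ranges of
  -- `θ` and `j` are ever used.
  obtain ⟨gθ, hgθ⟩ := θ.toAlgHom.toLinearMap.exists_leftInverse_of_injective
    (LinearMap.ker_eq_bot.mpr hθ)
  obtain ⟨gj, hgj⟩ := (j : B →ₗ[ℂ] M).exists_leftInverse_of_injective
    (LinearMap.ker_eq_bot.mpr hj)
  let R : M →ₗ[ℂ] (H →L[ℂ] H) := (ρ : A →ₗ[ℂ] (H →L[ℂ] H)) ∘ₗ gθ
  let P : M →ₗ[ℂ] (H →L[ℂ] H) := Φ ∘ₗ gj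
  have hR : ∀ a, R (θ a) = ρ a := fun a => congrArg ρ (LinearMap.congr_fun hgθ a)
  have hP : ∀ b, P (j b) = Φ b := fun b => congrArg Φ (LinearMap.congr_fun hgj b)
  have hθmem : ∀ a, θ a ∈ LinearMap.range θ.toAlgHom.toLinearMap := fun a => ⟨a, rfl⟩
  obtain ⟨F, hFΨ, hFstar, hFpos⟩ := exists_positive_extension (blockSubspace H θ j)
    (fun i => by
      cases i
      · exact ⟨1, map_one θ⟩
      · exact ⟨1, map_one θ⟩)
    (blockFunctional κ R P)
    (fun y hy hyN =>
      re_sum_blockFunctional_nonneg θ hθ j hj ρ Φ hideal hmod hκ hcb R P hR hP y hy hyN)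
  obtain ⟨K, _, _, _, π, e, he⟩ := exists_kolmogorov_decomposition F hFstar hFpos
  have hl : ∀ a h k, inner ℂ (e (.inl h)) (π (θ a) (e (.inl k))) = κ * inner ℂ h (ρ a k) := by
    intro a h k
    rw [he, hFΨ (.inl h) (.inl k) _ (hθmem a), ← hR]
    rfl
  have hr : ∀ a h k, inner ℂ (e (.inr h)) (π (θ a) (e (.inr k))) = κ * inner ℂ h (ρ a k) := by
    intro a h k
    rw [he, hFΨ (.inr h) (.inr k) _ (hθmem a), ← hR]
    rfl
  have hρ1 : ‖ρ 1‖ ≤ 1 := by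
    refine (NonUnitalStarAlgHom.norm_apply_le ρ 1).trans ?_
    rcases subsingleton_or_nontrivial A with hA | hA
    · rw [Subsingleton.elim (1 : A) 0, norm_zero]
      exact zero_le_one
    · exact CStarRing.norm_one.le
  have hmodule : ∀ e' : H → K, (∀ a h k, inner ℂ (e' h) (π (θ a) (e' k)) = κ * inner ℂ h (ρ a k)) →
      ∃ S : H →L[ℂ] K, (∀ h, S h = e' h) ∧ ‖S‖ ≤ √κ ∧ ∀ a ξ, S (ρ a ξ) = π (θ a) (S ξ) := by
    intro e' h'
    have h1 : ∀ h k, inner ℂ (e' h) (e' k) = κ * inner ℂ h (ρ 1 k) := by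
      intro h k
      rw [← h', map_one, map_one, _root_.one_apply_eq_self]
    obtain ⟨S, hS, hSn⟩ := exists_continuousLinearMap_of_inner e' (ρ 1) hρ1 hκ h1
    refine ⟨S, hS, hSn, fun a ξ => ?_⟩
    have hadj : ∀ (x : A) (η ζ : H), inner ℂ (ρ x η) ζ = inner ℂ η (ρ (star x) ζ) := by
      intro x η ζ
      rw [map_star, ContinuousLinearMap.star_eq_adjoint, ContinuousLinearMap.adjoint_inner_right]
    have hadj' : ∀ (x : A) (η ζ : K), inner ℂ (π (θ x) η) ζ = inner ℂ η (π (θ (star x)) ζ) := by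
      intro x η ζ
      rw [map_star, map_star, ContinuousLinearMap.star_eq_adjoint,
        ContinuousLinearMap.adjoint_inner_right]
    have hcomp : ∀ (x y : A) (ζ : H), ρ x (ρ y ζ) = ρ (x * y) ζ := by
      intro x y ζ
      rw [map_mul, _root_.mul_apply_eq_comp]
    have hcomp' : ∀ (x y : A) (ζ : K), π (θ x) (π (θ y) ζ) = π (θ (x * y)) ζ := by
      intro x y ζ
      rw [map_mul, map_mul, _root_.mul_apply_eq_comp]
    -- The squared norm of `S (ρ a ξ) - π (θ a) (S ξ)` expands into four terms, each `κ ⟪ξ, ρ (a* a)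
    -- ξ⟫` up to sign, and they cancel.
    rw [hS, hS, ← sub_eq_zero, ← inner_self_eq_zero (𝕜 := ℂ), inner_sub_left, inner_sub_right,
      inner_sub_right, h1, h', hadj', hadj', hcomp', h', h', hadj, hadj, hcomp, hcomp, hcomp]
    simp
  obtain ⟨S, hS, hSn, hSm⟩ := hmodule _ hl
  obtain ⟨T, hT, hTn, hTm⟩ := hmodule _ hr
  refine ⟨K, _, _, _, π, S, T, hSm, hTm, fun b => ?_, hSn, hTn⟩
  ext k
  refine ext_inner_left ℂ fun h => ?_
  rw [ContinuousLinearMap.comp_apply, ContinuousLinearMap.comp_apply,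
    ContinuousLinearMap.adjoint_inner_right, hS, hT, he,
    hFΨ (.inl h) (.inr k) _ (show j b ∈ LinearMap.range (j : B →ₗ[ℂ] M) from ⟨b, rfl⟩), ← hP]
  rfl

/-! ### Restriction to the nondegenerate part. -/

section EssentialPart

universe w

/-- Since `B` is an ideal, the closed span of `π(B)K` reduces π. The projection `V` onto it
therefore intertwines, and it loses nothing of `π(B)`. -/
theorem exists_nondegenerate_part {M B : Type*} {K : Type w} [CStarAlgebra M]
    [NonUnitalCStarAlgebra B] [NormedAddCommGroup K] [InnerProductSpace ℂ K] [CompleteSpace K]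
    (j : B →⋆ₙₐ[ℂ] M) (hideal : ∀ m b, ∃ c, j c = m * j b) (π : M →⋆ₐ[ℂ] (K →L[ℂ] K)) :
    ∃ (E : Type w) (_ : NormedAddCommGroup E) (_ : InnerProductSpace ℂ E) (_ : CompleteSpace E)
      (σ : B →⋆ₙₐ[ℂ] (E →L[ℂ] E)) (σ' : M →⋆ₐ[ℂ] (E →L[ℂ] E)) (V : K →L[ℂ] E),
      IsNondegenerate σ ∧ (∀ b, σ' (j b) = σ b) ∧ ‖V‖ ≤ 1 ∧ (∀ m x, V (π m x) = σ' m (V x)) ∧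
      ∀ b, π (j b) = ContinuousLinearMap.adjoint V ∘L σ b ∘L V := by
  let s : Set K := {x | ∃ (b : B) (ξ : K), π (j b) ξ = x}
  let E : Submodule ℂ K := (Submodule.span ℂ s).topologicalClosure
  have : CompleteSpace E := (Submodule.isClosed_topologicalClosure _).completeSpace_coe
  have hsE : ∀ b ξ, π (j b) ξ ∈ E := fun b ξ =>
    Submodule.le_topologicalClosure _ (Submodule.subset_span ⟨b, ξ, rfl⟩)
  have hspan : ∀ m, ∀ x ∈ Submodule.span ℂ s, π m x ∈ Submodule.span ℂ s := by
    intro m x hx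
    induction hx using Submodule.span_induction with
    | mem x hx =>
      obtain ⟨b, ξ, rfl⟩ := hx
      obtain ⟨c, hc⟩ := hideal m b
      refine Submodule.subset_span ⟨c, ξ, ?_⟩
      rw [hc, map_mul, _root_.mul_apply_eq_comp]
    | zero => rw [map_zero]; exact Submodule.zero_mem _
    | add x y _ _ hx hy => rw [map_add]; exact Submodule.add_mem _ hx hy
    | smul c x _ hx => rw [map_smul]; exact Submodule.smul_mem _ c hx
  have hE : ∀ m, ∀ x ∈ E, π m x ∈ E := fun m x hx =>
    map_mem_closure (π m).continuous hx fun y hy => hspan m y hy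
  let V : K →L[ℂ] E := E.orthogonalProjectionOnto
  let ι : E →L[ℂ] K := E.subtypeL
  have hVι : ∀ x, V (ι x) = x := fun x => E.orthogonalProjectionOnto_mem_subspace_eq_self x
  have hιV : ∀ x ∈ E, ι (V x) = x := fun x hx => congrArg ι (hVι ⟨x, hx⟩)
  have hVadj : ContinuousLinearMap.adjoint V = ι := E.adjoint_orthogonalProjectionOnto
  have hιadj : ContinuousLinearMap.adjoint ι = V := E.adjoint_subtypeL
  -- Moved to the other side of the inner product, `π (star m)` keeps `E` invariant, so the
  -- component of `x` orthogonal to `E` is not seen.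
  have hcomm : ∀ m x, V (π m x) = V (π m (ι (V x))) := by
    intro m x
    refine ext_inner_left ℂ fun y => ?_
    rw [← hιadj, ContinuousLinearMap.adjoint_inner_right, ContinuousLinearMap.adjoint_inner_right]
    have hadj : ∀ z, inner ℂ (ι y) (π m z) = inner ℂ (π (star m) (ι y)) z := by
      intro z
      rw [map_star, ContinuousLinearMap.star_eq_adjoint, ContinuousLinearMap.adjoint_inner_left]
    have h0 : ι (V (π (star m) (ι y))) = π (star m) (ι y) := hιV _ (hE _ _ y.2)
    rw [hadj, hadj, ← h0, ← ContinuousLinearMap.adjoint_inner_right ι,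
      ← ContinuousLinearMap.adjoint_inner_right ι, hιadj, hVι]
  let σ' : M →⋆ₐ[ℂ] (E →L[ℂ] E) :=
    { toFun := fun m => V ∘L π m ∘L ι
      map_one' := by
        ext1 x
        simp [hVι]
      map_mul' := fun m m' => by
        ext1 x
        simp only [map_mul, _root_.mul_apply_eq_comp, ContinuousLinearMap.comp_apply]
        exact hcomm _ _
      map_zero' := by
        ext1 x
        simp
      map_add' := fun m m' => by
        ext1 x
        simp
      commutes' := fun r => by
        ext1 x
        simp [Algebra.algebraMap_eq_smul_one, hVι]
      map_star' := fun m => by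
        rw [ContinuousLinearMap.star_eq_adjoint, ContinuousLinearMap.adjoint_comp,
          ContinuousLinearMap.adjoint_comp, hVadj, hιadj, map_star,
          ContinuousLinearMap.star_eq_adjoint]
        rfl }
  have hσ' : ∀ m x, σ' m x = V (π m (ι x)) := fun _ _ => rfl
  refine ⟨E, inferInstance, inferInstance, inferInstance,
    (σ' : M →⋆ₙₐ[ℂ] (E →L[ℂ] E)).comp j, σ', V, ?_, fun b => rfl,
    E.orthogonalProjectionOnto_norm_le, hcomm, fun b => ?_⟩
  · rw [IsNondegenerate, Subtype.dense_iff]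
    intro x hx
    refine closure_mono ?_ hx
    intro y hy
    rw [SetLike.mem_coe] at hy
    suffices h : Submodule.span ℂ s ≤ (Submodule.span ℂ
        {x : E | ∃ (b : B) (ξ : E), ((σ' : M →⋆ₙₐ[ℂ] (E →L[ℂ] E)).comp j) b ξ = x}).map
          E.subtype by
      exact h hy
    rw [Submodule.span_le]
    rintro _ ⟨b, ξ, rfl⟩
    refine ⟨V (π (j b) ξ), Submodule.subset_span ⟨b, V ξ, ?_⟩, hιV _ (hsE b ξ)⟩
    exact (hcomm _ _).symm
  · ext1 x
    rw [hVadj]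
    change π (j b) x = ι (V (π (j b) (ι (V x))))
    rw [← hcomm, hιV _ (hsE b x)]

end EssentialPart

/-! ### Completely bounded norm estimates. -/

section NormEstimates

variable {B H K : Type*} [NonUnitalCStarAlgebra B] [PartialOrder B] [StarOrderedRing B]
  [NormedAddCommGroup H] [InnerProductSpace ℂ H] [CompleteSpace H]
  [NormedAddCommGroup K] [InnerProductSpace ℂ K] [CompleteSpace K]

omit [CompleteSpace H] [CompleteSpace K] in
theorem norm_toLp_comp_le {n : Type*} [Fintype n] (T : H →L[ℂ] K) (x : PiLp 2 (fun _ : n => H)) :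
    ‖(WithLp.toLp 2 (fun i => T (x i)) : PiLp 2 (fun _ : n => K))‖ ≤ ‖T‖ * ‖x‖ := by
  rw [← sq_le_sq₀ (norm_nonneg _) (by positivity), mul_pow, PiLp.norm_sq_eq_of_L2,
    PiLp.norm_sq_eq_of_L2, Finset.mul_sum]
  refine Finset.sum_le_sum fun i _ => ?_
  rw [← mul_pow]
  exact pow_le_pow_left₀ (norm_nonneg _) (T.le_opNorm _) 2

/-- Applying `S` and `T` coordinatewise moves the form of `Φₙ(c)` to that of `πₙ(c)`, and `πₙ` is
contractive as a star homomorphism. -/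
theorem norm_map_le_of_eq_compression {n : Type*} [Fintype n] (π : B →⋆ₙₐ[ℂ] (K →L[ℂ] K))
    (S T : H →L[ℂ] K) (Φ : B →ₗ[ℂ] (H →L[ℂ] H))
    (hΦ : ∀ b, Φ b = ContinuousLinearMap.adjoint S ∘L π b ∘L T) (c : CStarMatrix n n B) :
    ‖c.map Φ‖ ≤ ‖S‖ * ‖T‖ * ‖c‖ := by
  rw [← norm_matrixOperator]
  refine ContinuousLinearMap.opNorm_le_bound _ (by positivity) fun x => ?_
  set C := matrixOperator (c.map Φ) with hC
  have h1 : ∀ y, ‖inner ℂ y (C x)‖ ≤ ‖S‖ * ‖T‖ * ‖c‖ * ‖x‖ * ‖y‖ := by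
    intro y
    have e : inner ℂ y (C x) = inner ℂ
        (WithLp.toLp 2 (fun i => S (y i)) : PiLp 2 (fun _ : n => K))
        (matrixOperator (c.map π) (WithLp.toLp 2 (fun i => T (x i)))) := by
      rw [hC, inner_matrixOperator, inner_matrixOperator]
      refine Finset.sum_congr rfl fun i _ => Finset.sum_congr rfl fun k _ => ?_
      rw [CStarMatrix.map_apply, CStarMatrix.map_apply, hΦ, ContinuousLinearMap.comp_apply,
        ContinuousLinearMap.comp_apply, ContinuousLinearMap.adjoint_inner_right]
    have hπ : ‖matrixOperator (c.map π)‖ ≤ ‖c‖ := by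
      rw [norm_matrixOperator]
      exact NonUnitalStarAlgHom.norm_apply_le (CStarMatrix.mapₙₐ π) c
    rw [e]
    calc _ ≤ _ := norm_inner_le_norm _ _
      _ ≤ (‖S‖ * ‖y‖) * (‖c‖ * (‖T‖ * ‖x‖)) := by
        gcongr
        · exact norm_toLp_comp_le S y
        · refine ((matrixOperator (c.map π)).le_of_opNorm_le hπ _).trans ?_
          gcongr
          exact norm_toLp_comp_le T x
      _ = _ := by ring
  have h2 := h1 (C x)
  rw [inner_self_eq_norm_sq_to_K] at h2
  rcases (norm_nonneg (C x)).eq_or_lt with h0 | h0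
  · rw [← h0]
    positivity
  · refine le_of_mul_le_mul_right ?_ h0
    simpa [sq] using h2

theorem cbNorm_le_of_eq_compression (π : B →⋆ₙₐ[ℂ] (K →L[ℂ] K))
    (S T : H →L[ℂ] K) (Φ : B →ₗ[ℂ] (H →L[ℂ] H))
    (hΦ : ∀ b, Φ b = ContinuousLinearMap.adjoint S ∘L π b ∘L T) : cbNorm Φ ≤ ‖S‖ₑ * ‖T‖ₑ := by
  refine iSup_le fun n => iSup₂_le fun c hc => ?_
  rw [← ofReal_norm, ← ofReal_norm, ← ofReal_norm, ← ENNReal.ofReal_mul (norm_nonneg _)]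
  refine ENNReal.ofReal_le_ofReal ((norm_map_le_of_eq_compression π S T Φ hΦ c).trans ?_)
  exact mul_le_of_le_one_right (by positivity) hc

/-- Needed because the positivity argument indexes matrices by finite sets of vectors, whereas
`cbNorm` uses `Fin n`; reindexing does not change norms. -/
theorem norm_map_le_cbNorm {n : Type*} [Fintype n] (Φ : B →ₗ[ℂ] (H →L[ℂ] H))
    (hΦ : IsCompletelyBounded Φ) (c : CStarMatrix n n B) (hc : ‖c‖ ≤ 1) :
    ‖c.map Φ‖ ≤ (cbNorm Φ).toReal := by
  let e := Fintype.equivFin n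
  let c' := CStarMatrix.reindexₐ ℂ B e c
  have h1 : ‖c'‖ ≤ 1 :=
    (NonUnitalStarAlgHom.norm_apply_le (CStarMatrix.reindexₐ ℂ B e) c).trans hc
  have h2 : c.map Φ = CStarMatrix.reindexₐ ℂ (H →L[ℂ] H) e.symm (c'.map Φ) := by
    ext1 i k
    change Φ (c i k) = Φ (c (e.symm (e i)) (e.symm (e k)))
    rw [e.symm_apply_apply, e.symm_apply_apply]
  have h3 : ‖c.map Φ‖ ≤ ‖c'.map Φ‖ := by
    rw [h2]
    exact NonUnitalStarAlgHom.norm_apply_le (CStarMatrix.reindexₐ ℂ (H →L[ℂ] H) e.symm) _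
  refine h3.trans ?_
  have h4 : ‖c'.map Φ‖ₑ ≤ cbNorm Φ :=
    (le_iSup₂ (f := fun (M : CStarMatrix (Fin (Fintype.card n)) (Fin (Fintype.card n)) B)
      (_ : ‖M‖ ≤ 1) => ‖M.map Φ‖ₑ) c' h1).trans (le_iSup (amplificationNorm Φ) _)
  rw [← toReal_enorm]
  exact ENNReal.toReal_mono hΦ.ne h4

end NormEstimates

/-! ### `B` as an ideal of its multiplier algebra. -/

section Multipliers

variable {B : Type*} [NonUnitalCStarAlgebra B]

theorem eq_of_forall_mul_left {x y : B} (h : ∀ c : B, c * x = c * y) : x = y := by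
  have h1 := h (star (x - y))
  rwa [← sub_eq_zero, ← mul_sub, CStarRing.star_mul_self_eq_zero_iff, sub_eq_zero] at h1

theorem eq_of_forall_mul_right {x y : B} (h : ∀ c : B, x * c = y * c) : x = y := by
  have h1 := h (star (x - y))
  rwa [← sub_eq_zero, ← sub_mul, CStarRing.mul_star_self_eq_zero_iff, sub_eq_zero] at h1

theorem coe_fst_eq_mul (m : 𝓜(ℂ, B)) (b : B) :
    ((m.fst b : B) : 𝓜(ℂ, B)) = m * (b : 𝓜(ℂ, B)) := by
  refine DoubleCentralizer.ext _ _ _ _ (Prod.ext ?_ ?_)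
  · ext x
    refine eq_of_forall_mul_left fun c => ?_
    change c * (m.fst b * x) = c * m.fst (b * x)
    rw [← m.central, ← mul_assoc, ← mul_assoc, m.central]
  · ext x
    exact (m.central x b).symm

theorem coe_snd_eq_mul (m : 𝓜(ℂ, B)) (b : B) :
    ((m.snd b : B) : 𝓜(ℂ, B)) = (b : 𝓜(ℂ, B)) * m := by
  refine DoubleCentralizer.ext _ _ _ _ (Prod.ext ?_ ?_)
  · ext x
    exact m.central b x
  · ext x
    refine eq_of_forall_mul_right fun c => ?_
    change x * m.snd b * c = m.snd (x * b) * c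
    rw [m.central, mul_assoc, mul_assoc, m.central]

theorem coeHom_injective :
    Function.Injective (DoubleCentralizer.coeHom (𝕜 := ℂ) (A := B)) := by
  intro x y h
  refine eq_of_forall_mul_right fun c => ?_
  exact congrArg (fun m : 𝓜(ℂ, B) => m.fst c) h

end Multipliers

/-! ### Assembly of the factorization. -/

/-- The dilation theorem for a unital C⋆-algebra `C` of multipliers through which `A` acts. -/
theorem exists_factorization_of_unital_extension {B : Type u} [NonUnitalCStarAlgebra B]
    [PartialOrder B] [StarOrderedRing B] {H : Type v} [NormedAddCommGroup H]
    [InnerProductSpace ℂ H] [CompleteSpace H]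
    (A : NonUnitalStarSubalgebra ℂ 𝓜(ℂ, B)) (ρ : A →⋆ₙₐ[ℂ] (H →L[ℂ] H))
    (Φ : B →ₗ[ℂ] (H →L[ℂ] H)) (hΦ : IsCompletelyBounded Φ)
    {C : Type*} [CStarAlgebra C] (θ : C →⋆ₐ[ℂ] 𝓜(ℂ, B)) (hθ : Function.Injective θ)
    (σ : C →⋆ₙₐ[ℂ] (H →L[ℂ] H)) (hA : ∀ a : A, ∃ c, θ c = a ∧ σ c = ρ a)
    (hl : ∀ c b, Φ ((θ c).fst b) = σ c * Φ b) (hr : ∀ c b, Φ ((θ c).snd b) = Φ b * σ c) :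
    ∃ (K : Type (max u v)) (_ : NormedAddCommGroup K) (_ : InnerProductSpace ℂ K)
      (_ : CompleteSpace K)
      (π : B →⋆ₙₐ[ℂ] (K →L[ℂ] K)) (π' : 𝓜(ℂ, B) →⋆ₐ[ℂ] (K →L[ℂ] K)) (S T : H →L[ℂ] K),
      IsNondegenerate π ∧ IsMultiplierExtension π π' ∧
      IsLeftModuleMap A ρ π' S ∧ IsLeftModuleMap A ρ π' T ∧
      (∀ b : B, Φ b = ContinuousLinearMap.adjoint S ∘L π b ∘L T) ∧
      cbNorm Φ = ‖S‖ₑ * ‖T‖ₑ := by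
  let : PartialOrder C := CStarAlgebra.spectralOrder C
  have : StarOrderedRing C := CStarAlgebra.spectralOrderedRing C
  let : PartialOrder 𝓜(ℂ, B) := CStarAlgebra.spectralOrder 𝓜(ℂ, B)
  have : StarOrderedRing 𝓜(ℂ, B) := CStarAlgebra.spectralOrderedRing 𝓜(ℂ, B)
  let j : B →⋆ₙₐ[ℂ] 𝓜(ℂ, B) := DoubleCentralizer.coeHom
  have hj : Function.Injective j := coeHom_injective
  have hideal : ∀ c b c', j ((θ c').snd ((θ c).fst b)) = θ c * j b * θ c' := by
    intro c b c'
    change ((((θ c').snd ((θ c).fst b)) : B) : 𝓜(ℂ, B)) = _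
    rw [coe_snd_eq_mul, coe_fst_eq_mul]
    rfl
  obtain ⟨K, _, _, _, π, S, T, hS, hT, hΦST, hSn, hTn⟩ :=
    exists_bimodule_dilation θ hθ j hj σ Φ (fun c b c' => ⟨_, hideal c b c'⟩)
      (fun c b c' d hd => by
        rw [← hideal] at hd
        rw [hj hd, hr, hl])
      (ENNReal.toReal_nonneg (a := cbNorm Φ))
      (fun L c hc => norm_map_le_cbNorm Φ hΦ c hc)
  obtain ⟨E, _, _, _, τ, τ', V, hnd, hext, hV, hVπ, hπV⟩ :=
    exists_nondegenerate_part j (fun m b => ⟨m.fst b, coe_fst_eq_mul m b⟩) π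
  have hfact : ∀ b, Φ b = ContinuousLinearMap.adjoint (V ∘L S) ∘L τ b ∘L (V ∘L T) := by
    intro b
    rw [hΦST, hπV, ContinuousLinearMap.adjoint_comp]
    rfl
  have hmodule : ∀ X : H →L[ℂ] K, (∀ c ξ, X (σ c ξ) = π (θ c) (X ξ)) →
      IsLeftModuleMap A ρ τ' (V ∘L X) := by
    intro X hX a ξ
    obtain ⟨c, hc, hc'⟩ := hA a
    rw [ContinuousLinearMap.comp_apply, ← hc', hX, hVπ, hc]
    rfl
  have hnorm : ∀ X : H →L[ℂ] K, ‖X‖ ≤ √(cbNorm Φ).toReal →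
      ‖V ∘L X‖ ≤ √(cbNorm Φ).toReal := fun X hX =>
    (V.opNorm_comp_le X).trans ((mul_le_of_le_one_left (norm_nonneg _) hV).trans hX)
  refine ⟨E, _, _, _, τ, τ', V ∘L S, V ∘L T, hnd, hext, hmodule S hS, hmodule T hT, hfact,
    le_antisymm (cbNorm_le_of_eq_compression τ _ _ Φ hfact) ?_⟩
  rw [← ofReal_norm, ← ofReal_norm, ← ENNReal.ofReal_mul (norm_nonneg _)]
  refine ENNReal.ofReal_le_of_le_toReal ?_
  calc _ ≤ √(cbNorm Φ).toReal * √(cbNorm Φ).toReal :=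
        mul_le_mul (hnorm S hSn) (hnorm T hTn) (norm_nonneg _) (Real.sqrt_nonneg _)
    _ = _ := Real.mul_self_sqrt ENNReal.toReal_nonneg

end OperatorModule

theorem mainTheorem2 {B : Type u} [NonUnitalCStarAlgebra B] [PartialOrder B]
    [StarOrderedRing B] {H : Type v} [NormedAddCommGroup H] [InnerProductSpace ℂ H]
    [CompleteSpace H]
    (A : NonUnitalStarSubalgebra ℂ 𝓜(ℂ, B)) (hA_closed : IsClosed (A : Set 𝓜(ℂ, B)))
    (hA_comm : ∀ a ∈ A, ∀ a' ∈ A, a * a' = a' * a)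
    (ρ : A →⋆ₙₐ[ℂ] (H →L[ℂ] H))
    (Φ : B →ₗ[ℂ] (H →L[ℂ] H))
    (hΦ_cb : OperatorModule.IsCompletelyBounded Φ)
    (hΦ_mod : OperatorModule.IsBimoduleMap A ρ Φ) :
    ∃ (K : Type (max u v)) (_ : NormedAddCommGroup K) (_ : InnerProductSpace ℂ K)
      (_ : CompleteSpace K)
      (π : B →⋆ₙₐ[ℂ] (K →L[ℂ] K)) (π' : 𝓜(ℂ, B) →⋆ₐ[ℂ] (K →L[ℂ] K)) (S T : H →L[ℂ] K),
      OperatorModule.IsNondegenerate π ∧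
      OperatorModule.IsMultiplierExtension π π' ∧
      OperatorModule.IsLeftModuleMap A ρ π' S ∧
      OperatorModule.IsLeftModuleMap A ρ π' T ∧
      (∀ b : B, Φ b = ContinuousLinearMap.adjoint S ∘L π b ∘L T) ∧
      OperatorModule.cbNorm Φ = ‖S‖ₑ * ‖T‖ₑ := by
  -- The unitization of `A` embeds in `M(B)` only if `1 ∉ A`. If `1 ∈ A`, then `A` itself serves,
  -- with `ρ 1` possibly a proper projection.
  by_cases h1 : (1 : 𝓜(ℂ, B)) ∈ A
  · let A₁ : StarSubalgebra ℂ 𝓜(ℂ, B) :=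
      { A with
        one_mem' := h1
        algebraMap_mem' := fun r => by
          rw [Algebra.algebraMap_eq_smul_one]
          exact SMulMemClass.smul_mem r h1 }
    have : IsClosed (A₁ : Set 𝓜(ℂ, B)) := hA_closed
    let σ : A₁ →⋆ₙₐ[ℂ] (H →L[ℂ] H) :=
      { toFun := fun a => ρ ⟨a, a.2⟩
        map_smul' := fun c a => map_smul ρ c (⟨a, a.2⟩ : A)
        map_zero' := map_zero ρ
        map_add' := fun a a' => map_add ρ (⟨a, a.2⟩ : A) ⟨a', a'.2⟩
        map_mul' := fun a a' => map_mul ρ (⟨a, a.2⟩ : A) ⟨a', a'.2⟩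
        map_star' := fun a => map_star ρ (⟨a, a.2⟩ : A) }
    exact OperatorModule.exists_factorization_of_unital_extension A ρ Φ hΦ_cb A₁.subtype
      Subtype.val_injective σ (fun a => ⟨⟨a, a.2⟩, rfl, rfl⟩)
      (fun a b => hΦ_mod.map_left ⟨a, a.2⟩ b) (fun a b => hΦ_mod.map_right ⟨a, a.2⟩ b)
  · have : IsClosed (A : Set 𝓜(ℂ, B)) := hA_closed
    let σ : Unitization ℂ A →⋆ₙₐ[ℂ] (H →L[ℂ] H) :=
      (Unitization.starLift ρ : Unitization ℂ A →⋆ₐ[ℂ] (H →L[ℂ] H))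
    have hσ : ∀ x, σ x = algebraMap ℂ (H →L[ℂ] H) x.fst + ρ x.snd := fun _ => rfl
    refine OperatorModule.exists_factorization_of_unital_extension A ρ Φ hΦ_cb
      (NonUnitalStarSubalgebra.unitization A)
      (NonUnitalStarSubalgebra.unitization_injective A h1) σ
      (fun a => ⟨(a : Unitization ℂ A), by simp, by simp [hσ]⟩) (fun c b => ?_) (fun c b => ?_)
    · have := hΦ_mod.map_left c.snd b
      simp [hσ, add_mul, this, Algebra.algebraMap_eq_smul_one]
    · have := hΦ_mod.map_right c.snd b
      simp [hσ, mul_add, this, Algebra.algebraMap_eq_smul_one]
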